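/- Let $q$ be a prime power. Represent $\Pi_3=PG(3,q^6)$ in $PG(9,q^2)$ by the Barlotti–Cofman representation: fix a hyperplane $\Sigma$ of $PG(9,q^2)$ and a desarguesian spread $\mathcal S$ of $\Sigma$ by planes (the one-dimensional $\mathbb F_{q^6}$-subspaces of $\mathbb F_{q^6}^3$, viewed over $\mathbb F_{q^2}$); the points of $\Pi_3$ are the points of $PG(9,q^2)\setminus\Sigma$ and the elements of $\mathcal S$. Write $\mathfrak K(\Omega,A)=\bigcup_{a\in A}\langle \Omega,a\rangle$ for the cone with vertex $\Omega$ and base $A$. Choose the following. - Distinct elements $X,X'$ of $\mathcal S$, a point $p\in X$, a $7$-dimensional subspace $\Gamma$ of $\Sigma$ with $X'\subseteq\Gamma$ and $p\notin\Gamma$, points $r,\tilde q$ with $\Gamma\cap X=\langle r,\tilde q\rangle$, and an $8$-dimensional subspace $\Gamma'$ of $PG(9,q^2)$ with $\Gamma'\cap\Sigma=\Gamma$. - A plane $\pi\not\subseteq\Sigma$ of $\Gamma'$ through $\tilde q$ and a point $t\in X'$, a Baer subplane $V$ of $\pi$ with $V\cap\langle t,\tilde q\rangle=\{\tilde q\}$,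 the line $L$ of $\pi$ through $t$ that meets $V$ in $q+1$ points, and a point $s\in V\cap L$. Put $\bar B=\mathfrak K(r,(V\setminus L)\cup\{s\})$. - Lines $L_1,L_2,L_3$ of $X'$ with $L_1\cap L_2\cap L_3=\emptyset$, none of which contains $t$ or a point $\tilde t\in X'\setminus\{t\}$ such that $\langle p,Z\rangle\cap\langle t,r\rangle\neq\emptyset$ for all $Z\in\mathcal S$ with $Z\subset\langle X,X'\rangle$ and $\tilde t\in\langle p,Z\rangle$. - A point $h\in\Gamma'\setminus\Sigma$ with $h\notin\langle X,X',V\rangle$. Put $\tilde B=\mathfrak K(h,L_1\cup L_2\cup L_3)\setminus\Sigma$. Let $B$ be the set of points of $\Pi_3$ given by $\mathfrak K(p,\bar B\cup\tilde B)$, that is, the points of this cone outside $\Sigma$ together with the elements of $\mathcal S$ that meet it. Then $B$ is a minimal blocking set of $PG(3,q^6)$ (with respect to planes), $|B|=4q^6-3q^4+q^2+1$, and no collineation of $PG(3,q^6)$ maps $B$ to a blocking set obtained by the MPS construction. Here a set is obtained by the MPS construction in $PG(3,q^6)$ if, for some subfield $\mathbb F_{q_1}$ with $q^6=q_1^n$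 and $n\ge2$, in the Barlotti–Cofman representation of $PG(3,q_1^n)$ in $PG(3n,q_1)$ with hyperplane $\Sigma_1$ and desarguesian spread $\mathcal S_1$, it consists of the points outside $\Sigma_1$ of a cone $\mathfrak K(\Omega,C)$ and the elements of $\mathcal S_1$ that meet the cone, where $\Omega$ is a hyperplane of some $Y\in\mathcal S_1$, $C$ is a blocking set (with respect to hyperplanes) of a $(2n+1)$-dimensional subspace $\Gamma_1'$ disjoint from $\Omega$, $C$ meets $\Sigma_1$ in exactly one point, and $\ell\setminus\{t_1\}\not\subset C$ for every line $\ell$ of $\Gamma_1'$ through the point $t_1=\Gamma_1'\cap Y$. -/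

import Mathlib

open scoped LinearAlgebra.Projectivization

/-! Projective subspaces are given by linear subspaces; a subspace of projective dimension `d` is a
`Submodule` of `finrank` `d + 1`. -/

/-- The set of points of the projective subspace given by `W`. -/
def pointsOf {F E : Type*} [Field F] [AddCommGroup E] [Module F E] (W : Submodule F E) :
    Set (ℙ F E) :=
  {x | x.submodule ≤ W}

/-- The cone with vertex `Ω` and base `A`: the union of the subspaces `⟨Ω, a⟩`, `a ∈ A`. -/
def coneOver {F E : Type*} [Field F] [AddCommGroup E] [Module F E] (Ω : Submodule F E)
    (A : Set (ℙ F E)) : Set (ℙ F E) :=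
  {x | ∃ a ∈ A, x.submodule ≤ Ω ⊔ a.submodule}

/-- `A` is a blocking set of the projective space `Γ`: a set of points of `Γ` that meets every
hyperplane of `Γ`. -/
def IsBlockingSetOf {F E : Type*} [Field F] [AddCommGroup E] [Module F E] (Γ : Submodule F E)
    (A : Set (ℙ F E)) : Prop :=
  A ⊆ pointsOf Γ ∧
    ∀ H : Submodule F E, H ≤ Γ → Module.finrank F H + 1 = Module.finrank F Γ →
      (A ∩ pointsOf H).Nonempty

/-- `A` is a blocking set of `Γ` that is minimal with respect to inclusion. -/
def IsMinimalBlockingSetOf {F E : Type*} [Field F] [AddCommGroup E] [Module F E]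
    (Γ : Submodule F E) (A : Set (ℙ F E)) : Prop :=
  Minimal (IsBlockingSetOf Γ) A

/-- A collineation: a bijection on points that preserves collinearity in both directions. -/
def IsCollineation {K E : Type*} [Field K] [AddCommGroup E] [Module K E]
    (σ : ℙ K E ≃ ℙ K E) : Prop :=
  ∀ x y z : ℙ K E, x.submodule ≤ y.submodule ⊔ z.submodule ↔
    (σ x).submodule ≤ (σ y).submodule ⊔ (σ z).submodule

/-- `V` is a Baer subplane of the plane `π` over `k`, where `k` is a quadratic extension of `F`:
the points with coordinates in `F` with respect to some basis of `π`. -/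
def IsBaerSubplane (F : Type*) {k E : Type*} [Field F] [Field k] [Algebra F k] [AddCommGroup E]
    [Module k E] (π : Submodule k E) (V : Set (ℙ k E)) : Prop :=
  ∃ e : Fin 3 → E, LinearIndependent k e ∧ Submodule.span k (Set.range e) = π ∧
    V = {x | ∃ c : Fin 3 → F,
      x.submodule = Submodule.span k {∑ i, algebraMap F k (c i) • e i}}

/-! ### The Barlotti-Cofman representation of `PG(r, K)` over a subfield `F`

With `n = [K : F]`, the space `Σ' = PG(nr, F)` is the projective space of the `F`-space `K ^ r × F`,
its hyperplane `Σ = PG(nr - 1, F)` is `K ^ r × 0`, and the desarguesian `(n-1)`-spread of `Σ` consists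
of the one-dimensional `K`-subspaces of `K ^ r`, read over `F`. The space `PG(r, K)` that is
represented is the projective space of `K ^ r × K`. -/

/-- The vector space underlying `Σ' = PG(nr, F)`. -/
abbrev BCSpace (F K : Type*) (r : ℕ) : Type _ := (Fin r → K) × F

/-- The hyperplane `Σ` of `Σ'`. -/
def sigmaHyp (F K : Type*) [Field F] [Field K] [Algebra F K] (r : ℕ) :
    Submodule F (BCSpace F K r) :=
  (⊤ : Submodule F (Fin r → K)).prod ⊥

/-- The element of the desarguesian spread of `Σ` given by the point `Z` of `PG(r - 1, K)`. -/
def spreadElt (F : Type*) {K : Type*} [Field F] [Field K] [Algebra F K] {r : ℕ}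
    (Z : ℙ K (Fin r → K)) : Submodule F (BCSpace F K r) :=
  (Z.submodule.restrictScalars F).prod ⊥

/-- The inclusion of `K ^ r × F` into `K ^ r × K`. -/
def bcInclusion (F K : Type*) [Field F] [Field K] [Algebra F K] (r : ℕ) :
    BCSpace F K r →ₛₗ[algebraMap F K] BCSpace K K r where
  toFun v := (v.1, algebraMap F K v.2)
  map_add' v w := by simp
  map_smul' c v := by
    ext <;> simp [Algebra.smul_def]

theorem bcInclusion_injective (F K : Type*) [Field F] [Field K] [Algebra F K] (r : ℕ) :
    Function.Injective (bcInclusion F K r) := by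
  rintro ⟨v, a⟩ ⟨w, b⟩ h
  have h' : v = w ∧ algebraMap F K a = algebraMap F K b := by
    simpa [bcInclusion] using h
  exact Prod.ext h'.1 ((algebraMap F K).injective h'.2)

/-- The point of `PG(r, K)` that is represented by a point of `Σ'` outside `Σ`. -/
noncomputable def affinePoint {F K : Type*} [Field F] [Field K] [Algebra F K] {r : ℕ} :
    ℙ F (BCSpace F K r) → ℙ K (BCSpace K K r) :=
  Projectivization.map (bcInclusion F K r) (bcInclusion_injective F K r)

/-- The point of `PG(r, K)` that is represented by a spread element. -/
noncomputable def pointAtInfinity {K : Type*} [Field K] {r : ℕ} :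
    ℙ K (Fin r → K) → ℙ K (BCSpace K K r) :=
  Projectivization.map (LinearMap.inl K (Fin r → K) K) LinearMap.inl_injective

/-- The set of points of `PG(r, K)` determined by a set `A` of points of `Σ'`: the points of `A`
outside `Σ` together with the spread elements that meet `A`. -/
def representedSet {F K : Type*} [Field F] [Field K] [Algebra F K] {r : ℕ}
    (A : Set (ℙ F (BCSpace F K r))) : Set (ℙ K (BCSpace K K r)) :=
  affinePoint '' (A \ pointsOf (sigmaHyp F K r)) ∪
    pointAtInfinity '' {Z | (A ∩ pointsOf (spreadElt F Z)).Nonempty}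

/-- `B` is obtained in `PG(r, K)` by the MPS construction over the field `F`, `n = [K : F] ≥ 2`:
`Ω` is a hyperplane of a spread element `Y`, `Γ'` is a subspace of projective dimension
`(r - 1) n + 1` disjoint from `Ω`, `t` is the point `Γ' ∩ Y`, and `C` is a blocking set of `Γ'` that
meets `Σ` in one point and contains no set `ℓ \ {t}` with `ℓ` a line of `Γ'` through `t`. -/
def IsMPSOver (F : Type*) {K : Type*} [Field F] [Field K] [Algebra F K] {r : ℕ}
    (B : Set (ℙ K (BCSpace K K r))) : Prop :=
  2 ≤ Module.finrank F K ∧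
  ∃ (Y : ℙ K (Fin r → K)) (Ω Γ' : Submodule F (BCSpace F K r)) (t u : ℙ F (BCSpace F K r))
    (C : Set (ℙ F (BCSpace F K r))),
    Ω ≤ spreadElt F Y ∧ Module.finrank F Ω + 1 = Module.finrank F (spreadElt F Y) ∧
    Module.finrank F Γ' = (r - 1) * Module.finrank F K + 2 ∧ Γ' ⊓ Ω = ⊥ ∧
    t.submodule = Γ' ⊓ spreadElt F Y ∧
    IsBlockingSetOf Γ' C ∧ C ∩ pointsOf (sigmaHyp F K r) = {u} ∧
    (∀ ℓ : Submodule F (BCSpace F K r), Module.finrank F ℓ = 2 → ℓ ≤ Γ' → t.submodule ≤ ℓ →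
      ¬ pointsOf ℓ \ {t} ⊆ C) ∧
    B = representedSet (coneOver Ω C)

/-- `B` is a blocking set of class MPS of `PG(r, K)`: it is obtained by the MPS construction over
some subfield of `K`. -/
def IsMPS {K : Type*} [Field K] {r : ℕ} (B : Set (ℙ K (BCSpace K K r))) : Prop :=
  ∃ F : Subfield K, IsMPSOver F B

/-! ### The example -/

/-- `y` has the property that `⟨p, Z⟩` meets the line `⟨t, r⟩` for all spread elements
`Z ⊆ ⟨X, X'⟩` with `y ∈ ⟨p, Z⟩`. -/
def IsSpecialPoint {k K : Type*} [Field k] [Field K] [Algebra k K] (X X' : ℙ K (Fin 3 → K))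
    (p r t y : ℙ k (BCSpace k K 3)) : Prop :=
  ∀ Z : ℙ K (Fin 3 → K), spreadElt k Z ≤ spreadElt k X ⊔ spreadElt k X' →
    y.submodule ≤ p.submodule ⊔ spreadElt k Z →
    (pointsOf (p.submodule ⊔ spreadElt k Z) ∩ pointsOf (t.submodule ⊔ r.submodule)).Nonempty

/-- The cone with vertex `r` over `(V \ L) ∪ {s}`. -/
def barB {k K : Type*} [Field k] [Field K] [Algebra k K] (r : ℙ k (BCSpace k K 3))
    (V : Set (ℙ k (BCSpace k K 3))) (L : Submodule k (BCSpace k K 3))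
    (s : ℙ k (BCSpace k K 3)) : Set (ℙ k (BCSpace k K 3)) :=
  coneOver r.submodule ((V \ pointsOf L) ∪ {s})

/-- The affine part of the cone with vertex `h` over `L₁ ∪ L₂ ∪ L₃`. -/
def tildeB {k K : Type*} [Field k] [Field K] [Algebra k K] (h : ℙ k (BCSpace k K 3))
    (L₁ L₂ L₃ : Submodule k (BCSpace k K 3)) : Set (ℙ k (BCSpace k K 3)) :=
  coneOver h.submodule (pointsOf L₁ ∪ pointsOf L₂ ∪ pointsOf L₃) \ pointsOf (sigmaHyp k K 3)

/-! Everything happens in affine coordinates of `K ^ 3`. Let `p₀` and `t₀` be vectors of `p` and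
`t`; they span `X` and `X'` over `K`. Let `m` be an affine point of `V` on `L`, and `w = h₀ - m`,
where `h₀` is the position of `h`. Since `h` is outside `⟨X, X', V⟩`, the vectors `p₀, t₀, w` form a
basis. Write `r` and `q₀` as the points of `ρ • p₀` and `σ • p₀`; then `1, ρ, σ` is a `k`-basis of
`K`, because `p` is outside `Γ`.

With origin `m`, the affine part of `B` consists of the triples `(b + aρ + yσ, f y, 0)` and `(b, n,
1)`, where `b, a, y` run over `k`, `n` runs over the union of three planes `N₁, N₂, N₃` of `K`, and
`f` describes `(V \ L) ∪ {s}` as a graph (`exists_baer_coords`, `representedSet_eq_coords`). The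
only point at infinity is `X`. A plane that misses `X` has an equation `x + βy + γz = d`.

Blocking (`exists_coords_eq`): the first family meets the plane if `β` lies in `⟨1, ρ⟩`. Otherwise
`β⁻¹` is outside some `Nᵢ`, and the second family meets it.

Minimality: each point needs a tangent plane. For the second family take `β = x⁻¹`, where the line
through `n` with direction `x` meets the three planes only in `n`, and `x⁻¹` is outside `⟨1, ρ⟩`.
The first family can then be avoided because `y + l * f y` is not a permutation of `k` for `l ≠ 0`
(`baerGraph_not_injective`). The condition on special points says that inverses of nonzero elements
of the `Nᵢ` are outside `⟨1, ρ⟩` (`isSpecialPoint_of_inv_eq`).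

Not MPS: an MPS set over a field of order `q₁`, with `q₁ ^ n = q ^ 6`, has size `1` modulo `q₁ ^ (n
- 1)`, hence modulo `q ^ 3`, whereas `|B| - 1` is `q ^ 2` modulo `q ^ 3`. A collineation preserves
cardinality, so nothing more about it matters. -/

/-! ### Blocking, tangents and counting in coordinates -/

section Coordinates

variable {k K : Type*} [Field k] [Field K] [Algebra k K]

/-- The points of the cone over the affine part of `barB`, in coordinates. -/
def barCoords (ρ σ : K) (f : k → k) : Set (K × K × K) :=
  {v | ∃ b a y : k, v = (b • (1 : K) + a • ρ + y • σ, algebraMap k K (f y), 0)}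

/-- The points of the cone over `tildeB`, in coordinates. -/
def tildeCoords (N₁ N₂ N₃ : Submodule k K) : Set (K × K × K) :=
  {v | ∃ b : k, ∃ n : K, (n ∈ N₁ ∨ n ∈ N₂ ∨ n ∈ N₃) ∧ v = (algebraMap k K b, n, 1)}

/-- `1, ρ, σ` is a basis of `K` over `k`. -/
def IsCoordTriple (k : Type*) {K : Type*} [Field k] [Field K] [Algebra k K] (ρ σ : K) : Prop :=
  Function.Bijective (fun c : k × k × k => c.1 • (1 : K) + c.2.1 • ρ + c.2.2 • σ)

theorem IsCoordTriple.ext {ρ σ : K} (hb : IsCoordTriple k ρ σ) {b a y b' a' y' : k}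
    (h : b • (1 : K) + a • ρ + y • σ = b' • (1 : K) + a' • ρ + y' • σ) :
    b = b' ∧ a = a' ∧ y = y' := by
  have := hb.1 (a₁ := (b, a, y)) (a₂ := (b', a', y')) h
  simpa using this

theorem IsCoordTriple.exists_rep {ρ σ : K} (hb : IsCoordTriple k ρ σ) (d : K) :
    ∃ b a y : k, d = b • (1 : K) + a • ρ + y • σ := by
  obtain ⟨⟨b, a, y⟩, h⟩ := hb.2 d
  exact ⟨b, a, y, h.symm⟩

theorem finrank_inf_eq_one [FiniteDimensional k K] (hkK : Module.finrank k K = 3)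
    {N₁ N₂ : Submodule k K} (h₁ : Module.finrank k N₁ = 2) (h₂ : Module.finrank k N₂ = 2)
    (hne : N₁ ≠ N₂) : Module.finrank k (N₁ ⊓ N₂ : Submodule k K) = 1 := by
  have h := Submodule.finrank_sup_add_finrank_inf_eq N₁ N₂
  have h3 := Submodule.finrank_le (N₁ ⊔ N₂)
  have h4 : Module.finrank k (N₁ ⊓ N₂ : Submodule k K) ≠ 2 := by
    intro h5
    apply hne
    have e1 := Submodule.eq_of_le_of_finrank_eq (inf_le_left : N₁ ⊓ N₂ ≤ N₁) (by omega)
    have e2 := Submodule.eq_of_le_of_finrank_eq (inf_le_right : N₁ ⊓ N₂ ≤ N₂) (by omega)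
    exact e1.symm.trans e2
  have h5 := Submodule.finrank_mono (inf_le_left : N₁ ⊓ N₂ ≤ N₁)
  omega

/-- Three planes through the origin with trivial intersection are pairwise distinct. -/
theorem ne_of_inf_inf_eq_bot [FiniteDimensional k K] (hkK : Module.finrank k K = 3)
    {N₁ N₂ N₃ : Submodule k K} (h₁ : Module.finrank k N₁ = 2) (h₃ : Module.finrank k N₃ = 2)
    (hN : N₁ ⊓ N₂ ⊓ N₃ = ⊥) : N₁ ≠ N₂ := by
  rintro rfl
  rw [inf_idem] at hN
  have h := Submodule.finrank_sup_add_finrank_inf_eq N₁ N₃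
  have h3 := Submodule.finrank_le (N₁ ⊔ N₃)
  rw [hN, finrank_bot] at h
  omega

/-- This is the blocking property for planes off `X`. The two families complement each other: the
first handles `β` in `⟨1, ρ⟩`, the second all other `β`. -/
theorem exists_coords_eq [FiniteDimensional k K] (hkK : Module.finrank k K = 3)
    {ρ σ : K} (hb : IsCoordTriple k ρ σ) (f : k → k)
    {N₁ N₂ N₃ : Submodule k K} (h₁ : Module.finrank k N₁ = 2) (h₂ : Module.finrank k N₂ = 2)
    (h₃ : Module.finrank k N₃ = 2) (hN : N₁ ⊓ N₂ ⊓ N₃ = ⊥) (β γ d : K) :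
    ∃ v ∈ barCoords ρ σ f ∪ tildeCoords N₁ N₂ N₃, v.1 + β * v.2.1 + γ * v.2.2 = d := by
  by_cases hβ : ∃ b a : k, β = b • (1 : K) + a • ρ
  · obtain ⟨b, a, rfl⟩ := hβ
    obtain ⟨b', a', y, rfl⟩ := hb.exists_rep d
    -- Here `β * f y` has no `σ`-component, so `y` is read off from `d` and the other two
    -- coordinates absorb the correction.
    refine ⟨_, Or.inl ⟨b' - f y * b, a' - f y * a, y, rfl⟩, ?_⟩
    simp only [Algebra.smul_def, map_sub, map_mul]
    ring
  · have hβ0 : β ≠ 0 := by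
      rintro rfl
      exact hβ ⟨0, 0, by simp⟩
    -- A plane `N` that misses `β⁻¹` satisfies `N + k β⁻¹ = K`; decompose `β⁻¹ * (d - γ)` and
    -- multiply by `β`.
    have key : ∀ N : Submodule k K, Module.finrank k N = 2 → β⁻¹ ∉ N →
        ∃ b : k, ∃ n ∈ N, algebraMap k K b + β * n = d - γ := by
      intro N hN2 hβN
      have hlt : N < N ⊔ Submodule.span k {β⁻¹} := by
        refine lt_of_le_of_ne le_sup_left fun h => hβN ?_
        rw [h]
        exact Submodule.mem_sup_right (Submodule.mem_span_singleton_self _)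
      have htop : N ⊔ Submodule.span k {β⁻¹} = ⊤ := by
        apply Submodule.eq_top_of_finrank_eq
        have := Submodule.finrank_lt_finrank_of_lt hlt
        have := Submodule.finrank_le (N ⊔ Submodule.span k {β⁻¹})
        omega
      have hmem : β⁻¹ * (d - γ) ∈ N ⊔ Submodule.span k {β⁻¹} := htop ▸ Submodule.mem_top
      obtain ⟨n, hn, z, hz, hnz⟩ := Submodule.mem_sup.1 hmem
      obtain ⟨b, rfl⟩ := Submodule.mem_span_singleton.1 hz
      refine ⟨b, n, hn, ?_⟩
      rw [Algebra.smul_def] at hnz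
      field_simp at hnz
      rw [← hnz]
      ring
    have hor : β⁻¹ ∉ N₁ ∨ β⁻¹ ∉ N₂ ∨ β⁻¹ ∉ N₃ := by
      by_contra! hc
      have : β⁻¹ ∈ N₁ ⊓ N₂ ⊓ N₃ := ⟨⟨hc.1, hc.2.1⟩, hc.2.2⟩
      rw [hN, Submodule.mem_bot] at this
      exact inv_ne_zero hβ0 this
    rcases hor with h | h | h
    · obtain ⟨b, n, hn, e⟩ := key _ h₁ h
      exact ⟨_, Or.inr ⟨b, n, Or.inl hn, rfl⟩, by simp [e]⟩
    · obtain ⟨b, n, hn, e⟩ := key _ h₂ h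
      exact ⟨_, Or.inr ⟨b, n, Or.inr (Or.inl hn), rfl⟩, by simp [e]⟩
    · obtain ⟨b, n, hn, e⟩ := key _ h₃ h
      exact ⟨_, Or.inr ⟨b, n, Or.inr (Or.inr hn), rfl⟩, by simp [e]⟩

/-- With `β = 0` only the first coordinate counts on the first family, and it determines the point.
The choice of `γ` would force `b' = ρ` on the second family, impossible since `ρ` is not in `k`. -/
theorem exists_tangent_of_mem_barCoords
    {ρ σ : K} (hb : IsCoordTriple k ρ σ) (f : k → k)
    {N₁ N₂ N₃ : Submodule k K} {v : K × K × K} (hv : v ∈ barCoords ρ σ f) :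
    ∃ β γ : K, ∀ w ∈ barCoords ρ σ f ∪ tildeCoords N₁ N₂ N₃,
      w.1 + β * w.2.1 + γ * w.2.2 = v.1 + β * v.2.1 + γ * v.2.2 → w = v := by
  obtain ⟨b, a, y, rfl⟩ := hv
  refine ⟨0, b • (1 : K) + a • ρ + y • σ - ρ, ?_⟩
  rintro w (⟨b', a', y', rfl⟩ | ⟨b', n, -, rfl⟩) h
  · simp only [zero_mul, add_zero, mul_zero] at h
    obtain ⟨rfl, rfl, rfl⟩ := hb.ext h
    rfl
  · exfalso
    simp only [zero_mul, add_zero, mul_zero, mul_one] at h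
    have : b' • (1 : K) + (0 : k) • ρ + (0 : k) • σ = (0 : k) • (1 : K) + (1 : k) • ρ + (0 : k) • σ := by
      simp only [zero_smul, add_zero, zero_add, one_smul]
      rw [Algebra.smul_def, mul_one]
      linear_combination h
    have := (hb.ext this).2.1
    exact zero_ne_one this

/-- A direction `x` for which the line through `n` meets the three planes only in `n`. -/
def IsTangentDirection (N₁ N₂ N₃ : Submodule k K) (n x : K) : Prop :=
  ∀ c : k, ∀ n' : K, (n' ∈ N₁ ∨ n' ∈ N₂ ∨ n' ∈ N₃) → n' = n + c • x → n' = n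

/-- Taking `β = x⁻¹` turns the equation on the second family into membership of `n'` in the line
through `n` with direction `x`. On the first family the `σ`-component of the equation is `y + l * f
y = μ`, which fails for a suitable `μ`. -/
theorem exists_tangent_of_direction [Finite k]
    {ρ σ : K} (hb : IsCoordTriple k ρ σ) (f : k → k)
    (hf : ∀ l : k, l ≠ 0 → ¬ Function.Injective fun y => y + l * f y)
    {N₁ N₂ N₃ : Submodule k K} {n x : K} (hx : x ≠ 0)
    (hxW : ∀ b a : k, x⁻¹ ≠ b • (1 : K) + a • ρ)
    (hxn : IsTangentDirection N₁ N₂ N₃ n x) (b : k) :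
    ∃ β γ : K, ∀ w ∈ barCoords ρ σ f ∪ tildeCoords N₁ N₂ N₃,
      w.1 + β * w.2.1 + γ * w.2.2 = algebraMap k K b + β * n + γ * 1 →
        w = (algebraMap k K b, n, 1) := by
  obtain ⟨b₀, a₀, l, hl⟩ := hb.exists_rep x⁻¹
  have hl0 : l ≠ 0 := by
    rintro rfl
    exact hxW b₀ a₀ (by simpa using hl)
  have hns : ¬ Function.Surjective fun y => y + l * f y :=
    fun h => hf l hl0 (Finite.injective_iff_surjective.2 h)
  obtain ⟨μ, hμ⟩ := not_forall.1 hns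
  -- This `γ` makes the right-hand side of the equation equal to `μσ`.
  refine ⟨x⁻¹, μ • σ - algebraMap k K b - x⁻¹ * n, ?_⟩
  rintro w (⟨b', a', y', rfl⟩ | ⟨b', n', hn', rfl⟩) h
  · exfalso
    apply hμ
    refine ⟨y', ?_⟩
    have : (b' + b₀ * f y') • (1 : K) + (a' + a₀ * f y') • ρ + (y' + l * f y') • σ
        = (0 : k) • (1 : K) + (0 : k) • ρ + μ • σ := by
      rw [hl] at h
      simp only [Algebra.smul_def, map_add, map_mul, map_zero] at h ⊢
      linear_combination h
    exact (hb.ext this).2.2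
  · simp only at h
    have e : n' = n + (b - b') • x := by
      rw [Algebra.smul_def, map_sub]
      field_simp at h
      linear_combination h
    have e' := hxn _ _ hn' e
    subst e'
    have : algebraMap k K b' = algebraMap k K b := by linear_combination h
    rw [this]

/-- A direction in `N₂ ⊓ N₃` is parallel to both planes that miss `n`, and transversal to `N₁`
because the triple intersection is trivial. -/
theorem exists_direction_of_mem_one [FiniteDimensional k K] (hkK : Module.finrank k K = 3)
    {N₁ N₂ N₃ : Submodule k K} (h₂ : Module.finrank k N₂ = 2)
    (h₃ : Module.finrank k N₃ = 2) (hN : N₁ ⊓ N₂ ⊓ N₃ = ⊥) {n : K}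
    (hn₁ : n ∈ N₁) (hn₂ : n ∉ N₂) (hn₃ : n ∉ N₃) :
    ∃ x ∈ N₂, x ≠ 0 ∧ IsTangentDirection N₁ N₂ N₃ n x := by
  have h := Submodule.finrank_sup_add_finrank_inf_eq N₂ N₃
  have h3 := Submodule.finrank_le (N₂ ⊔ N₃)
  have hne : N₂ ⊓ N₃ ≠ ⊥ := by
    intro h0
    rw [h0, finrank_bot] at h
    omega
  obtain ⟨x, hx, hx0⟩ := Submodule.exists_mem_ne_zero_of_ne_bot hne
  refine ⟨x, hx.1, hx0, ?_⟩
  rintro c n' hn' rfl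
  rcases hn' with hn' | hn' | hn'
  · have hc : c • x ∈ N₁ := by simpa using N₁.sub_mem hn' hn₁
    have : c • x ∈ N₁ ⊓ N₂ ⊓ N₃ := ⟨⟨hc, N₂.smul_mem _ hx.1⟩, N₃.smul_mem _ hx.2⟩
    rw [hN, Submodule.mem_bot] at this
    rw [this, add_zero]
  · exact absurd (by simpa using N₂.sub_mem hn' (N₂.smul_mem c hx.1)) hn₂
  · exact absurd (by simpa using N₃.sub_mem hn' (N₃.smul_mem c hx.2)) hn₃

/-- A direction in `N₃` outside `N₁` and `N₂` works; it exists because a group that lies in the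
union of two subgroups lies in one of them. -/
theorem exists_direction_of_mem_two [FiniteDimensional k K] (hkK : Module.finrank k K = 3)
    {N₁ N₂ N₃ : Submodule k K} (h₁ : Module.finrank k N₁ = 2) (h₂ : Module.finrank k N₂ = 2)
    (h₃ : Module.finrank k N₃ = 2) (hN : N₁ ⊓ N₂ ⊓ N₃ = ⊥) {n : K}
    (hn₁ : n ∈ N₁) (hn₂ : n ∈ N₂) (hn₃ : n ∉ N₃) :
    ∃ x ∈ N₃, x ≠ 0 ∧ IsTangentDirection N₁ N₂ N₃ n x := by
  have hne₁ : N₁ ≠ N₃ := ne_of_inf_inf_eq_bot (N₃ := N₂) hkK h₁ h₂ (by rwa [inf_right_comm])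
  have hne₂ : N₂ ≠ N₃ := ne_of_inf_inf_eq_bot (N₃ := N₁) hkK h₂ h₁
    (by rw [← hN, inf_comm, inf_assoc])
  have hx : ∃ x ∈ N₃, x ∉ N₁ ∧ x ∉ N₂ := by
    by_contra! hc
    have hle : (N₃ : Set K) ⊆ N₁ ∪ N₂ := by
      intro x hx
      by_cases h : x ∈ N₁
      · exact Or.inl h
      · exact Or.inr (hc x hx h)
    rcases AddSubgroupClass.subset_union.1 hle with h | h
    · exact hne₁ (Submodule.eq_of_le_of_finrank_eq h (by omega)).symm
    · exact hne₂ (Submodule.eq_of_le_of_finrank_eq h (by omega)).symm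
  obtain ⟨x, hx₃, hx₁, hx₂⟩ := hx
  have hc0 : ∀ (N : Submodule k K) (c : k), n ∈ N → x ∉ N → n + c • x ∈ N → n + c • x = n := by
    intro N c hn hx h
    by_cases hc : c = 0
    · simp [hc]
    · exact absurd ((N.smul_mem_iff hc).1 (by simpa using N.sub_mem h hn)) hx
  refine ⟨x, hx₃, fun h => hx₁ (h ▸ N₁.zero_mem), ?_⟩
  rintro c n' hn' rfl
  rcases hn' with hn' | hn' | hn'
  · exact hc0 _ _ hn₁ hx₁ hn'
  · exact hc0 _ _ hn₂ hx₂ hn'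
  · exact absurd (by simpa using N₃.sub_mem hn' (N₃.smul_mem c hx₃)) hn₃

theorem IsTangentDirection.rotate {N₁ N₂ N₃ : Submodule k K} {n x : K}
    (h : IsTangentDirection N₁ N₂ N₃ n x) : IsTangentDirection N₃ N₁ N₂ n x :=
  fun c n' hn' => h c n' (by tauto)

theorem natCard_of_finrank_eq_two [Finite k] [FiniteDimensional k K] {N : Submodule k K}
    (h : Module.finrank k N = 2) : Nat.card N = Nat.card k ^ 2 := by
  rw [Module.natCard_eq_pow_finrank (K := k), h]

/-- At `n = 0` no `Nᵢ` can contain the direction, so its inverse must be kept outside `⟨1, ρ⟩`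
separately. Counting does it: four sets of `|k|² - 1` nonzero elements cannot cover `K \ {0}` once
`|k| ≥ 4`. -/
theorem exists_direction_of_zero [Finite k] [FiniteDimensional k K]
    (hkK : Module.finrank k K = 3) (hk : 4 ≤ Nat.card k) {ρ σ : K} (hb : IsCoordTriple k ρ σ)
    {N₁ N₂ N₃ : Submodule k K} (h₁ : Module.finrank k N₁ = 2) (h₂ : Module.finrank k N₂ = 2)
    (h₃ : Module.finrank k N₃ = 2) :
    ∃ x : K, x ≠ 0 ∧ (∀ b a : k, x⁻¹ ≠ b • (1 : K) + a • ρ) ∧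
      IsTangentDirection N₁ N₂ N₃ 0 x := by
  have : Finite K := Module.finite_of_finite k
  let W : Set K := Set.range fun c : k × k => c.1 • (1 : K) + c.2 • ρ
  have hWcard : W.ncard = Nat.card k ^ 2 := by
    have hinj : Function.Injective fun c : k × k => c.1 • (1 : K) + c.2 • ρ := by
      rintro ⟨b, a⟩ ⟨b', a'⟩ h
      obtain ⟨rfl, rfl, -⟩ := hb.ext (y := 0) (y' := 0) (by simpa using h)
      rfl
    change (Set.range _).ncard = _
    rw [← Set.image_univ, Set.ncard_image_of_injective _ hinj, Set.ncard_univ, Nat.card_prod, sq]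
  have hW0 : (0 : K) ∈ W := ⟨(0, 0), by simp⟩
  have hcardK : Nat.card K = Nat.card k ^ 3 := by
    rw [Module.natCard_eq_pow_finrank (K := k), hkK]
  let Bad : Set K := ((N₁ : Set K) \ {0} ∪ (N₂ : Set K) \ {0}) ∪
    ((N₃ : Set K) \ {0} ∪ (fun x => x⁻¹) '' (W \ {0}))
  have hd : ∀ A : Set K, (0 : K) ∈ A → A.ncard = Nat.card k ^ 2 →
      (A \ {0}).ncard = Nat.card k ^ 2 - 1 := by
    intro A h0 hA
    rw [Set.ncard_sdiff_singleton_of_mem h0, hA]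
  have hNc : ∀ N : Submodule k K, Module.finrank k N = 2 →
      (N : Set K).ncard = Nat.card k ^ 2 := fun N hN => natCard_of_finrank_eq_two hN
  have hbad : Bad.ncard ≤ 4 * (Nat.card k ^ 2 - 1) := by
    have e1 := Set.ncard_union_le ((N₁ : Set K) \ {0} ∪ (N₂ : Set K) \ {0})
      ((N₃ : Set K) \ {0} ∪ (fun x => x⁻¹) '' (W \ {0}))
    have e2 := Set.ncard_union_le ((N₁ : Set K) \ {0}) ((N₂ : Set K) \ {0})
    have e3 := Set.ncard_union_le ((N₃ : Set K) \ {0}) ((fun x => x⁻¹) '' (W \ {0}))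
    have e4 : ((fun x => x⁻¹) '' (W \ {0})).ncard ≤ _ := Set.ncard_image_le (Set.toFinite _)
    rw [hd W hW0 hWcard] at e4
    rw [hd _ N₁.zero_mem (hNc _ h₁), hd _ N₂.zero_mem (hNc _ h₂)] at e2
    rw [hd _ N₃.zero_mem (hNc _ h₃)] at e3
    change (_ ∪ _ : Set K).ncard ≤ _
    omega
  have hlt : Bad.ncard < ({0}ᶜ : Set K).ncard := by
    rw [Set.ncard_compl, Set.ncard_singleton, hcardK]
    have h16 : 1 ≤ Nat.card k ^ 2 := Nat.one_le_pow _ _ (by omega)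
    have : 4 * Nat.card k ^ 2 ≤ Nat.card k ^ 3 := by
      rw [pow_succ _ 2, mul_comm]
      exact Nat.mul_le_mul_left _ hk
    omega
  obtain ⟨x, hx, hxB⟩ := Set.exists_mem_notMem_of_ncard_lt_ncard hlt
  have hx0 : x ≠ 0 := hx
  have hxN : ∀ N : Submodule k K, ((N : Set K) \ {0}) ⊆ Bad → x ∉ N :=
    fun N hN h => hxB (hN ⟨h, hx0⟩)
  have hx₁ : x ∉ N₁ := hxN _ fun y hy => Or.inl (Or.inl hy)
  have hx₂ : x ∉ N₂ := hxN _ fun y hy => Or.inl (Or.inr hy)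
  have hx₃ : x ∉ N₃ := hxN _ fun y hy => Or.inr (Or.inl hy)
  refine ⟨x, hx0, ?_, ?_⟩
  · intro b a h
    exact hxB (Or.inr (Or.inr ⟨x⁻¹, ⟨⟨(b, a), h.symm⟩, inv_ne_zero hx0⟩, inv_inv x⟩))
  · have hc0 : ∀ (N : Submodule k K) (c : k), x ∉ N → 0 + c • x ∈ N → 0 + c • x = 0 := by
      intro N c hx h
      by_cases hc : c = 0
      · simp [hc]
      · exact absurd ((N.smul_mem_iff hc).1 (by simpa using h)) hx
    rintro c n' hn' rfl
    rcases hn' with hn' | hn' | hn'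
    · exact hc0 _ _ hx₁ hn'
    · exact hc0 _ _ hx₂ hn'
    · exact hc0 _ _ hx₃ hn'

/-- The direction depends on how many of the planes contain `n`. For `n ≠ 0` it is taken inside one
of the planes, so `hW` keeps its inverse outside `⟨1, ρ⟩`. -/
theorem exists_tangent_of_mem_tildeCoords [Finite k] [FiniteDimensional k K]
    (hkK : Module.finrank k K = 3) (hk : 4 ≤ Nat.card k)
    {ρ σ : K} (hb : IsCoordTriple k ρ σ) (f : k → k)
    (hf : ∀ l : k, l ≠ 0 → ¬ Function.Injective fun y => y + l * f y)
    {N₁ N₂ N₃ : Submodule k K} (h₁ : Module.finrank k N₁ = 2) (h₂ : Module.finrank k N₂ = 2)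
    (h₃ : Module.finrank k N₃ = 2) (hN : N₁ ⊓ N₂ ⊓ N₃ = ⊥)
    (hW : ∀ x : K, (x ∈ N₁ ∨ x ∈ N₂ ∨ x ∈ N₃) → x ≠ 0 → ∀ b a : k, x⁻¹ ≠ b • (1 : K) + a • ρ)
    {v : K × K × K} (hv : v ∈ tildeCoords N₁ N₂ N₃) :
    ∃ β γ : K, ∀ w ∈ barCoords ρ σ f ∪ tildeCoords N₁ N₂ N₃,
      w.1 + β * w.2.1 + γ * w.2.2 = v.1 + β * v.2.1 + γ * v.2.2 → w = v := by
  obtain ⟨b, n, hn, rfl⟩ := hv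
  have hN' : N₂ ⊓ N₃ ⊓ N₁ = ⊥ := by rw [inf_comm, ← inf_assoc, hN]
  have hN'' : N₃ ⊓ N₁ ⊓ N₂ = ⊥ := by rw [inf_assoc, inf_comm, hN]
  have hmem : ∃ x : K, x ≠ 0 ∧ (∀ b a : k, x⁻¹ ≠ b • (1 : K) + a • ρ) ∧
      IsTangentDirection N₁ N₂ N₃ n x := by
    by_cases e₁ : n ∈ N₁ <;> by_cases e₂ : n ∈ N₂ <;> by_cases e₃ : n ∈ N₃
    · have h0 : n ∈ N₁ ⊓ N₂ ⊓ N₃ := ⟨⟨e₁, e₂⟩, e₃⟩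
      rw [hN, Submodule.mem_bot] at h0
      subst h0
      exact exists_direction_of_zero hkK hk hb h₁ h₂ h₃
    · obtain ⟨x, hx, hx0, hxn⟩ := exists_direction_of_mem_two hkK h₁ h₂ h₃ hN e₁ e₂ e₃
      exact ⟨x, hx0, hW x (by tauto) hx0, hxn⟩
    · obtain ⟨x, hx, hx0, hxn⟩ := exists_direction_of_mem_two hkK h₃ h₁ h₂ hN'' e₃ e₁ e₂
      exact ⟨x, hx0, hW x (by tauto) hx0, hxn.rotate.rotate⟩
    · obtain ⟨x, hx, hx0, hxn⟩ := exists_direction_of_mem_one hkK h₂ h₃ hN e₁ e₂ e₃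
      exact ⟨x, hx0, hW x (by tauto) hx0, hxn⟩
    · obtain ⟨x, hx, hx0, hxn⟩ := exists_direction_of_mem_two hkK h₂ h₃ h₁ hN' e₂ e₃ e₁
      exact ⟨x, hx0, hW x (by tauto) hx0, hxn.rotate⟩
    · obtain ⟨x, hx, hx0, hxn⟩ := exists_direction_of_mem_one hkK h₃ h₁ hN' e₂ e₃ e₁
      exact ⟨x, hx0, hW x (by tauto) hx0, hxn.rotate⟩
    · obtain ⟨x, hx, hx0, hxn⟩ := exists_direction_of_mem_one hkK h₁ h₂ hN'' e₃ e₁ e₂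
      exact ⟨x, hx0, hW x (by tauto) hx0, hxn.rotate.rotate⟩
    · tauto
  obtain ⟨x, hx0, hxW, hxn⟩ := hmem
  exact exists_tangent_of_direction hb f hf hx0 hxW hxn b

theorem ncard_barCoords {ρ σ : K} (hb : IsCoordTriple k ρ σ) (f : k → k) :
    (barCoords ρ σ f).ncard = Nat.card k ^ 3 := by
  have hinj : Function.Injective fun c : k × k × k =>
      ((c.1 • (1 : K) + c.2.1 • ρ + c.2.2 • σ, algebraMap k K (f c.2.2), 0) : K × K × K) := by
    intro c c' h
    exact hb.1 (congrArg Prod.fst h)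
  have : barCoords ρ σ f = (fun c : k × k × k =>
      ((c.1 • (1 : K) + c.2.1 • ρ + c.2.2 • σ, algebraMap k K (f c.2.2), 0) : K × K × K)) ''
      Set.univ := by
    ext v
    constructor
    · rintro ⟨b, a, y, rfl⟩
      exact ⟨(b, a, y), trivial, rfl⟩
    · rintro ⟨⟨b, a, y⟩, -, rfl⟩
      exact ⟨b, a, y, rfl⟩
  rw [this, Set.ncard_image_of_injective _ hinj, Set.ncard_univ, Nat.card_prod, Nat.card_prod]
  ring

/-- Inclusion–exclusion: the planes meet pairwise in `|k|` elements, and all three meet in `0`. -/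
theorem ncard_union_three [Finite k] [FiniteDimensional k K] (hkK : Module.finrank k K = 3)
    {N₁ N₂ N₃ : Submodule k K} (h₁ : Module.finrank k N₁ = 2) (h₂ : Module.finrank k N₂ = 2)
    (h₃ : Module.finrank k N₃ = 2) (hN : N₁ ⊓ N₂ ⊓ N₃ = ⊥) :
    ((N₁ ∪ N₂ ∪ N₃ : Set K).ncard : ℤ) = 3 * (Nat.card k : ℤ) ^ 2 - 3 * Nat.card k + 1 := by
  have : Finite K := Module.finite_of_finite k
  have h1 : ∀ N N' : Submodule k K, Module.finrank k N = 2 → Module.finrank k N' = 2 → N ≠ N' →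
      ((N : Set K) ∩ N').ncard = Nat.card k := by
    intro N N' hN hN' hne
    have := Module.natCard_eq_pow_finrank (K := k) (V := (N ⊓ N' : Submodule k K))
    rw [finrank_inf_eq_one hkK hN hN' hne, pow_one] at this
    exact this
  have h12 : N₁ ≠ N₂ := ne_of_inf_inf_eq_bot hkK h₁ h₃ hN
  have h13 : N₁ ≠ N₃ := ne_of_inf_inf_eq_bot (N₃ := N₂) hkK h₁ h₂ (by rwa [inf_right_comm])
  have h23 : N₂ ≠ N₃ := ne_of_inf_inf_eq_bot (N₃ := N₁) hkK h₂ h₁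
    (by rw [← hN, inf_comm, inf_assoc])
  have c1 : (N₁ : Set K).ncard = _ := natCard_of_finrank_eq_two h₁
  have c2 : (N₂ : Set K).ncard = _ := natCard_of_finrank_eq_two h₂
  have c3 : (N₃ : Set K).ncard = _ := natCard_of_finrank_eq_two h₃
  have e1 := Set.ncard_union_add_ncard_inter (N₁ : Set K) N₂
  have e2 := Set.ncard_union_add_ncard_inter (N₁ ∪ N₂ : Set K) N₃
  have e3 := Set.ncard_union_add_ncard_inter (N₁ ∩ N₃ : Set K) (N₂ ∩ N₃)
  rw [Set.union_inter_distrib_right] at e2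
  have e4 : ((N₁ : Set K) ∩ N₃ ∩ (N₂ ∩ N₃)) = {0} := by
    rw [← Set.inter_inter_distrib_right]
    have := congrArg (fun N : Submodule k K => (N : Set K)) hN
    simpa using this
  rw [e4, Set.ncard_singleton, h1 _ _ h₁ h₃ h13, h1 _ _ h₂ h₃ h23] at e3
  rw [h1 _ _ h₁ h₂ h12, c1, c2] at e1
  rw [c3] at e2
  zify at e1 e2 e3
  linarith

theorem ncard_coords [Finite k] [FiniteDimensional k K] (hkK : Module.finrank k K = 3)
    {ρ σ : K} (hb : IsCoordTriple k ρ σ) (f : k → k)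
    {N₁ N₂ N₃ : Submodule k K} (h₁ : Module.finrank k N₁ = 2) (h₂ : Module.finrank k N₂ = 2)
    (h₃ : Module.finrank k N₃ = 2) (hN : N₁ ⊓ N₂ ⊓ N₃ = ⊥) :
    ((barCoords ρ σ f ∪ tildeCoords N₁ N₂ N₃).ncard : ℤ) =
      4 * (Nat.card k : ℤ) ^ 3 - 3 * (Nat.card k : ℤ) ^ 2 + Nat.card k := by
  have : Finite K := Module.finite_of_finite k
  have hdisj : Disjoint (barCoords ρ σ f) (tildeCoords N₁ N₂ N₃) := by
    rw [Set.disjoint_left]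
    rintro _ ⟨b, a, y, rfl⟩ ⟨b', n, -, h⟩
    exact zero_ne_one (congrArg (fun v : K × K × K => v.2.2) h)
  have ht : tildeCoords N₁ N₂ N₃ = (fun c : k × K => (algebraMap k K c.1, c.2, (1 : K))) ''
      (Set.univ ×ˢ (N₁ ∪ N₂ ∪ N₃ : Set K)) := by
    ext v
    constructor
    · rintro ⟨b, n, hn, rfl⟩
      exact ⟨(b, n), ⟨trivial, by simpa [or_assoc] using hn⟩, rfl⟩
    · rintro ⟨⟨b, n⟩, ⟨-, hn⟩, rfl⟩
      exact ⟨b, n, by simpa [or_assoc] using hn, rfl⟩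
  have hinj : Function.Injective fun c : k × K => (algebraMap k K c.1, c.2, (1 : K)) := by
    rintro ⟨b, n⟩ ⟨b', n'⟩ h
    simp only [Prod.mk.injEq, and_true] at h
    exact Prod.ext ((algebraMap k K).injective h.1) h.2
  rw [Set.ncard_union_eq hdisj, ncard_barCoords hb, ht, Set.ncard_image_of_injective _ hinj,
    Set.ncard_prod, Set.ncard_univ]
  push_cast
  rw [ncard_union_three hkK h₁ h₂ h₃ hN]
  ring

end Coordinates

/-! ### Points of a projective space as one-dimensional subspaces -/

section Points

variable {F E : Type*} [Field F] [AddCommGroup E] [Module F E]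

theorem mem_pointsOf {W : Submodule F E} {x : ℙ F E} : x ∈ pointsOf W ↔ x.submodule ≤ W := Iff.rfl

theorem mk_submodule_le {W : Submodule F E} {v : E} (hv : v ≠ 0) :
    (Projectivization.mk F v hv).submodule ≤ W ↔ v ∈ W := by
  rw [Projectivization.submodule_mk, Submodule.span_singleton_le_iff_mem]

theorem exists_submodule_eq_span (x : ℙ F E) : ∃ v : E, v ≠ 0 ∧ x.submodule = Submodule.span F {v} :=
  ⟨x.rep, x.rep_nonzero, by rw [Projectivization.submodule_eq]⟩

theorem eq_mk_of_submodule_eq {x : ℙ F E} {v : E} (hv : v ≠ 0)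
    (h : x.submodule = Submodule.span F {v}) : x = Projectivization.mk F v hv :=
  Projectivization.submodule_injective (by rw [h, Projectivization.submodule_mk])

theorem eq_of_submodule_le {x y : ℙ F E} (h : x.submodule ≤ y.submodule) : x = y := by
  have : FiniteDimensional F y.submodule :=
    Module.finite_of_finrank_pos (by rw [Projectivization.finrank_submodule]; norm_num)
  exact Projectivization.submodule_injective (Submodule.eq_of_le_of_finrank_eq h
    (by rw [Projectivization.finrank_submodule, Projectivization.finrank_submodule]))

theorem inf_submodule_eq_bot {W : Submodule F E} {x : ℙ F E} (h : ¬ x.submodule ≤ W) :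
    W ⊓ x.submodule = ⊥ := by
  obtain ⟨v, hv, hx⟩ := exists_submodule_eq_span x
  rw [hx] at h ⊢
  rw [Submodule.span_singleton_le_iff_mem] at h
  rw [Submodule.eq_bot_iff]
  rintro w ⟨hw, hw'⟩
  obtain ⟨c, rfl⟩ := Submodule.mem_span_singleton.1 hw'
  by_contra hc
  exact h ((W.smul_mem_iff (fun h0 => hc (by rw [h0, zero_smul]))).1 hw)

theorem finrank_sup_points [FiniteDimensional F E] {x y : ℙ F E} (h : x ≠ y) :
    Module.finrank F (x.submodule ⊔ y.submodule : Submodule F E) = 2 := by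
  have h1 := Submodule.finrank_sup_add_finrank_inf_eq x.submodule y.submodule
  rw [inf_submodule_eq_bot fun hle => h (eq_of_submodule_le hle).symm, finrank_bot,
    Projectivization.finrank_submodule, Projectivization.finrank_submodule] at h1
  simpa using h1

end Points

/-! ### Affine points, points at infinity and cones in the Barlotti–Cofman space -/

section BarlottiCofman

theorem prod_one_ne_zero (F : Type*) {K : Type*} [Field F] [Field K] {r : ℕ} (v : Fin r → K) :
    ((v, 1) : BCSpace F K r) ≠ 0 :=
  fun h => one_ne_zero (congrArg Prod.snd h)

variable (F : Type*) {K : Type*} [Field F] [Field K] [Algebra F K] {r : ℕ}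

/-- The affine point with position vector `v`. -/
def affPt (v : Fin r → K) : ℙ F (BCSpace F K r) :=
  Projectivization.mk F (v, 1) (prod_one_ne_zero F v)

theorem affPt_submodule (v : Fin r → K) :
    (affPt F v).submodule = Submodule.span F {((v, 1) : BCSpace F K r)} :=
  Projectivization.submodule_mk _ _

variable {F}

theorem mem_sigmaHyp {v : BCSpace F K r} : v ∈ sigmaHyp F K r ↔ v.2 = 0 := by
  simp [sigmaHyp]

theorem mem_spreadElt {Z : ℙ K (Fin r → K)} {v : BCSpace F K r} :
    v ∈ spreadElt F Z ↔ v.1 ∈ Z.submodule ∧ v.2 = 0 := by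
  simp [spreadElt]

theorem spreadElt_le_sigmaHyp (Z : ℙ K (Fin r → K)) : spreadElt F Z ≤ sigmaHyp F K r :=
  fun _ hv => mem_sigmaHyp.2 (mem_spreadElt.1 hv).2

theorem affPt_submodule_le {W : Submodule F (BCSpace F K r)} {v : Fin r → K} :
    (affPt F v).submodule ≤ W ↔ (v, 1) ∈ W := mk_submodule_le _

theorem affPt_notMem_sigmaHyp (v : Fin r → K) : affPt F v ∉ pointsOf (sigmaHyp F K r) := by
  rw [mem_pointsOf, affPt_submodule_le, mem_sigmaHyp]
  exact one_ne_zero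

theorem eq_affPt {x : ℙ F (BCSpace F K r)} {w : BCSpace F K r} (h2 : w.2 ≠ 0)
    (hw : x.submodule = Submodule.span F {w}) : x = affPt F (w.2⁻¹ • w.1) := by
  refine eq_mk_of_submodule_eq _ ?_
  have e : ((w.2⁻¹ • w.1, 1) : BCSpace F K r) = w.2⁻¹ • w := by
    ext
    · rfl
    · simp [h2]
  rw [hw, e]
  exact (Submodule.span_singleton_smul_eq (IsUnit.mk0 _ (inv_ne_zero h2)) _).symm

theorem exists_eq_affPt {x : ℙ F (BCSpace F K r)} (hx : x ∉ pointsOf (sigmaHyp F K r)) :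
    ∃ v, x = affPt F v := by
  obtain ⟨w, hw0, hw⟩ := exists_submodule_eq_span x
  rw [mem_pointsOf, hw, Submodule.span_singleton_le_iff_mem, mem_sigmaHyp] at hx
  exact ⟨_, eq_affPt hx hw⟩

theorem exists_submodule_eq_span_of_mem_sigmaHyp {x : ℙ F (BCSpace F K r)}
    (hx : x ∈ pointsOf (sigmaHyp F K r)) :
    ∃ v : Fin r → K, v ≠ 0 ∧ x.submodule = Submodule.span F {((v, 0) : BCSpace F K r)} := by
  obtain ⟨w, hw0, hw⟩ := exists_submodule_eq_span x
  rw [mem_pointsOf, hw, Submodule.span_singleton_le_iff_mem, mem_sigmaHyp] at hx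
  have e : w = (w.1, 0) := Prod.ext rfl hx
  exact ⟨w.1, fun h => hw0 (by rw [e, h]; rfl), e ▸ hw⟩

theorem affPt_injective : Function.Injective (affPt F : (Fin r → K) → _) := by
  intro v w h
  have h' : ((v, 1) : BCSpace F K r) ∈ (affPt F w).submodule := by
    rw [← affPt_submodule_le, h]
  rw [affPt_submodule, Submodule.mem_span_singleton] at h'
  obtain ⟨a, ha⟩ := h'
  have h2 : a * 1 = 1 := congrArg Prod.snd ha
  rw [mul_one] at h2
  have h1 : a • w = v := congrArg Prod.fst ha
  rw [← h1, h2, one_smul]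

theorem affinePoint_affPt (v : Fin r → K) : affinePoint (affPt F v) = affPt K v := by
  unfold affPt affinePoint
  rw [Projectivization.map_mk]
  simp [bcInclusion]

theorem pointAtInfinity_submodule_le {Z : ℙ K (Fin r → K)} {H : Submodule K (BCSpace K K r)} :
    (pointAtInfinity Z).submodule ≤ H ↔ ∀ v ∈ Z.submodule, (v, 0) ∈ H := by
  induction Z using Projectivization.ind with
  | h v hv =>
    rw [pointAtInfinity, Projectivization.map_mk, mk_submodule_le, Projectivization.submodule_mk]
    constructor
    · intro h w hw
      obtain ⟨c, rfl⟩ := Submodule.mem_span_singleton.1 hw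
      simpa using H.smul_mem c h
    · intro h
      exact h v (Submodule.mem_span_singleton_self v)

theorem pointAtInfinity_mem_sigmaHyp (Z : ℙ K (Fin r → K)) :
    pointAtInfinity Z ∈ pointsOf (sigmaHyp K K r) :=
  pointAtInfinity_submodule_le.2 fun _ _ => mem_sigmaHyp.2 rfl

theorem pointAtInfinity_injective :
    Function.Injective (pointAtInfinity : ℙ K (Fin r → K) → _) :=
  Projectivization.map_injective _ _

/-- A vertex at infinity acts by translations: the affine part of the cone is the affine part of the
base plus the vectors of the vertex. -/
theorem affPt_mem_coneOver {Ω : Submodule F (BCSpace F K r)} (hΩ : Ω ≤ sigmaHyp F K r)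
    {A : Set (ℙ F (BCSpace F K r))} {v : Fin r → K} :
    affPt F v ∈ coneOver Ω A ↔ ∃ w, affPt F w ∈ A ∧ (v - w, 0) ∈ Ω := by
  constructor
  · rintro ⟨a, ha, hle⟩
    rw [affPt_submodule_le] at hle
    have haS : a ∉ pointsOf (sigmaHyp F K r) := fun h =>
      one_ne_zero (mem_sigmaHyp.1 (sup_le hΩ h hle))
    obtain ⟨w, rfl⟩ := exists_eq_affPt haS
    refine ⟨w, ha, ?_⟩
    rw [affPt_submodule] at hle
    obtain ⟨y, hy, z, hz, hyz⟩ := Submodule.mem_sup.1 hle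
    obtain ⟨c, rfl⟩ := Submodule.mem_span_singleton.1 hz
    have hy2 := mem_sigmaHyp.1 (hΩ hy)
    have h2 : y.2 + c * 1 = 1 := congrArg Prod.snd hyz
    rw [hy2, zero_add, mul_one] at h2
    have h1 : y.1 + c • w = v := congrArg Prod.fst hyz
    rw [h2, one_smul] at h1
    have e : y = (v - w, 0) := Prod.ext (by simp [← h1]) hy2
    exact e ▸ hy
  · rintro ⟨w, hw, hvw⟩
    refine ⟨_, hw, ?_⟩
    rw [affPt_submodule_le]
    have e : ((v, 1) : BCSpace F K r) = (v - w, 0) + (w, 1) := by simp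
    rw [e]
    refine Submodule.add_mem_sup hvw ?_
    rw [affPt_submodule]
    exact Submodule.mem_span_singleton_self _

/-- For an affine point `a`, the space `⟨Ω, a⟩` meets `Σ` only in `Ω`, so affine base points
contribute nothing new at infinity. -/
theorem le_or_exists_of_mem_coneOver {Ω : Submodule F (BCSpace F K r)} (hΩ : Ω ≤ sigmaHyp F K r)
    {A : Set (ℙ F (BCSpace F K r))} {x : ℙ F (BCSpace F K r)}
    (hx : x ∈ pointsOf (sigmaHyp F K r)) (hxA : x ∈ coneOver Ω A) :
    x.submodule ≤ Ω ∨ ∃ a ∈ A, a ∈ pointsOf (sigmaHyp F K r) ∧ x.submodule ≤ Ω ⊔ a.submodule := by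
  obtain ⟨a, ha, hle⟩ := hxA
  by_cases haS : a ∈ pointsOf (sigmaHyp F K r)
  · exact Or.inr ⟨a, ha, haS, hle⟩
  · left
    intro z hz
    obtain ⟨y, hy, u, hu, rfl⟩ := Submodule.mem_sup.1 (hle hz)
    have hz2 := mem_sigmaHyp.1 (hx hz)
    have hy2 := mem_sigmaHyp.1 (hΩ hy)
    have hu2 : u ∈ sigmaHyp F K r := by
      rw [mem_sigmaHyp]
      simpa [hy2] using hz2
    have : u ∈ sigmaHyp F K r ⊓ a.submodule := ⟨hu2, hu⟩
    rw [inf_submodule_eq_bot haS, Submodule.mem_bot] at this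
    rwa [this, add_zero]

theorem representedSet_eq (A : Set (ℙ F (BCSpace F K r))) :
    representedSet A = affPt K '' {v | affPt F v ∈ A} ∪
      pointAtInfinity '' {Z | (A ∩ pointsOf (spreadElt F Z)).Nonempty} := by
  unfold representedSet
  congr 1
  ext y
  constructor
  · rintro ⟨x, ⟨hxA, hxS⟩, rfl⟩
    obtain ⟨v, rfl⟩ := exists_eq_affPt hxS
    exact ⟨v, hxA, (affinePoint_affPt v).symm⟩
  · rintro ⟨v, hv, rfl⟩
    exact ⟨_, ⟨hv, affPt_notMem_sigmaHyp v⟩, affinePoint_affPt v⟩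

theorem ncard_affPt_union_pointAtInfinity [Finite K] (A : Set (Fin r → K))
    (I : Set (ℙ K (Fin r → K))) :
    (affPt K '' A ∪ pointAtInfinity '' I).ncard = A.ncard + I.ncard := by
  have : Finite (ℙ K (Fin r → K)) := Quotient.finite _
  have hd : Disjoint (affPt K '' A) (pointAtInfinity '' I) := by
    rw [Set.disjoint_left]
    rintro _ ⟨v, -, rfl⟩ ⟨Z, -, hZ⟩
    exact affPt_notMem_sigmaHyp v (hZ ▸ pointAtInfinity_mem_sigmaHyp Z)
  rw [Set.ncard_union_eq hd (Set.toFinite _) (Set.toFinite _),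
    Set.ncard_image_of_injective _ affPt_injective,
    Set.ncard_image_of_injective _ pointAtInfinity_injective]

end BarlottiCofman

/-! ### Coordinates of the Baer subplane -/

section Baer

variable {F k : Type*} [Field F] [Field k] [Algebra F k]

/-- A basis `1, ω` of a quadratic extension, with the coordinate function of `ω`. -/
theorem exists_quadratic_coordinate (hFk : Module.finrank F k = 2) :
    ∃ (ω : k) (c : k →ₗ[F] F), c 1 = 0 ∧ c ω = 1 ∧
      ∀ z : k, ∃ b : F, z = algebraMap F k b + algebraMap F k (c z) * ω := by
  have : FiniteDimensional F k := Module.finite_of_finrank_pos (by omega)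
  obtain ⟨ω, hω⟩ : ∃ ω : k, LinearIndependent F ![(1 : k), ω] :=
    exists_linearIndependent_pair_of_one_lt_finrank (by omega) one_ne_zero
  let b := basisOfLinearIndependentOfCardEqFinrank hω (by simp [hFk])
  have hb : ⇑b = ![(1 : k), ω] := coe_basisOfLinearIndependentOfCardEqFinrank _ _
  have hb0 : b 0 = 1 := by rw [hb]; rfl
  have hb1 : b 1 = ω := by rw [hb]; rfl
  refine ⟨ω, b.coord 1, ?_, ?_, fun z => ⟨b.coord 0 z, ?_⟩⟩
  · rw [← hb0]
    simp
  · rw [← hb1]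
    simp
  · have := b.sum_repr z
    rw [Fin.sum_univ_two, hb0, hb1, Algebra.smul_def, Algebra.smul_def, mul_one] at this
    exact this.symm

/-- The graph of the Baer subplane, with the points of the real line through `t` replaced by one
point. -/
noncomputable def baerGraph (c : k →ₗ[F] F) (x₀ : k) (y : k) : k :=
  open Classical in if y = 0 then x₀ else y * algebraMap F k (c y⁻¹)

/-- Geometrically, each point of `⟨t, q₀⟩` other than `t` and `q₀` lies on a real line, and such a
line has two points of `V` off `L`; these give the same value of `y + l * f y`. With `y = z⁻¹` the
value is `μ` exactly when `1 + l * c z = μ * z`, so two nonzero solutions `z` are exhibited. -/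
theorem baerGraph_not_injective {ω : k} {c : k →ₗ[F] F} (hc1 : c 1 = 0) (hcω : c ω = 1)
    (hc : ∀ z : k, ∃ b : F, z = algebraMap F k b + algebraMap F k (c z) * ω) (x₀ : k)
    {l : k} (hl : l ≠ 0) : ¬ Function.Injective fun y => y + l * baerGraph c x₀ y := by
  have hcF : ∀ a : F, c (algebraMap F k a) = 0 := by
    intro a
    rw [Algebra.algebraMap_eq_smul_one, map_smul, hc1, smul_zero]
  have hcmul : ∀ (a : F) (z : k), c (algebraMap F k a * z) = a * c z := by
    intro a z
    rw [← Algebra.smul_def, map_smul, smul_eq_mul]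
  have key : ∀ (z z' μ : k), z ≠ 0 → z' ≠ 0 → z ≠ z' →
      1 + l * algebraMap F k (c z) = μ * z → 1 + l * algebraMap F k (c z') = μ * z' →
      ¬ Function.Injective fun y => y + l * baerGraph c x₀ y := by
    intro z z' μ hz hz' hne e e' hinj
    have hval : ∀ z : k, z ≠ 0 → 1 + l * algebraMap F k (c z) = μ * z →
        z⁻¹ + l * baerGraph c x₀ z⁻¹ = μ := by
      intro z hz e
      rw [baerGraph, if_neg (inv_ne_zero hz), inv_inv]
      field_simp
      linear_combination e
    have := hinj ((hval z hz e).trans (hval z' hz' e').symm)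
    exact hne (inv_injective this)
  have hω : ∀ a : F, algebraMap F k a ≠ ω := by
    intro a h
    have := hcF a
    rw [h, hcω] at this
    exact one_ne_zero this
  have hinjF := (algebraMap F k).injective
  -- If `l = a` is in `F`, take `μ = 0` and two elements `z` with `c z = -a⁻¹`. Otherwise take `μ =
  -- c l` and `z = (1 + l * a) / c l` for `a = 0, 1`, for which `c z = a`.
  by_cases hcl : c l = 0
  · obtain ⟨a, ha⟩ := hc l
    rw [hcl, map_zero, zero_mul, add_zero] at ha
    subst ha
    have ha0 : a ≠ 0 := by
      rintro rfl
      exact hl (map_zero _)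
    have hne : ∀ b : F, algebraMap F k b - ω * algebraMap F k a⁻¹ ≠ 0 := by
      intro b h
      apply hω (b * a)
      rw [map_mul]
      rw [map_inv₀] at h
      field_simp at h
      linear_combination h
    have hcz : ∀ b : F, c (algebraMap F k b - ω * algebraMap F k a⁻¹) = - a⁻¹ := by
      intro b
      rw [map_sub, hcF, mul_comm, hcmul, hcω]
      ring
    refine key (algebraMap F k 0 - ω * algebraMap F k a⁻¹)
      (algebraMap F k 1 - ω * algebraMap F k a⁻¹) 0 (hne 0) (hne 1) ?_ ?_ ?_
    · intro h
      rw [map_zero, map_one] at h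
      exact zero_ne_one (α := k) (by linear_combination h)
    · rw [hcz, map_neg, map_inv₀]
      field_simp
      ring
    · rw [hcz, map_neg, map_inv₀]
      field_simp
      ring
  · have hlF : ∀ a : F, 1 + l * algebraMap F k a ≠ 0 := by
      intro a h
      have h1 : c (1 + l * algebraMap F k a) = c 0 := by rw [h]
      rw [map_add, hc1, mul_comm, hcmul, map_zero, zero_add] at h1
      have ha : a = 0 := (mul_eq_zero.1 h1).resolve_right hcl
      rw [ha, map_zero, mul_zero, add_zero] at h
      exact one_ne_zero h
    have hcl' : algebraMap F k (c l) ≠ 0 := fun h => hcl (hinjF (h.trans (map_zero _).symm))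
    have hcz : ∀ a : F, c (algebraMap F k (c l)⁻¹ * (1 + l * algebraMap F k a)) = a := by
      intro a
      rw [hcmul, map_add, hc1, mul_comm l, hcmul]
      field_simp
      ring
    have hne : ∀ a : F, algebraMap F k (c l)⁻¹ * (1 + l * algebraMap F k a) ≠ 0 := fun a =>
      mul_ne_zero (by rw [map_inv₀]; exact inv_ne_zero hcl') (hlF a)
    refine key _ _ (algebraMap F k (c l)) (hne 0) (hne 1) ?_ ?_ ?_
    · intro h
      have := congrArg c h
      rw [hcz, hcz] at this
      exact zero_ne_one this
    · rw [hcz, map_inv₀]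
      field_simp
    · rw [hcz, map_inv₀]
      field_simp

variable {E : Type*} [AddCommGroup E] [Module k E]

/-- The vectors with coordinates in `F` with respect to `e`. -/
def ratVec (F : Type*) {k E : Type*} [Field F] [Field k] [Algebra F k] [AddCommGroup E]
    [Module k E] (e : Fin 3 → E) (c : Fin 3 → F) : E :=
  ∑ i, algebraMap F k (c i) • e i

theorem ratVec_add (e : Fin 3 → E) (c d : Fin 3 → F) :
    ratVec (k := k) F e (c + d) = ratVec (k := k) F e c + ratVec (k := k) F e d := by
  simp [ratVec, add_smul, Finset.sum_add_distrib]

theorem ratVec_smul (e : Fin 3 → E) (a : F) (c : Fin 3 → F) :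
    ratVec (k := k) F e (a • c) = algebraMap F k a • ratVec (k := k) F e c := by
  simp [ratVec, mul_smul, Finset.smul_sum]

/-- Coordinates are unique, so `z` is the ratio of two coordinates in `F`, taken where `d` is
nonzero. -/
theorem exists_eq_smul_of_ratVec_eq_smul {e : Fin 3 → E} (he : LinearIndependent k e)
    {c d : Fin 3 → F} (hd : d ≠ 0) {z : k}
    (h : ratVec (k := k) F e c = z • ratVec (k := k) F e d) :
    ∃ a : F, z = algebraMap F k a ∧ c = a • d := by
  have hi : ∀ i, algebraMap F k (c i) = z * algebraMap F k (d i) := by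
    simp only [ratVec, Finset.smul_sum, smul_smul] at h
    exact fun i => congrFun (he.fintypeLinearCombination_injective
      (a₁ := fun i => algebraMap F k (c i)) (a₂ := fun i => z * algebraMap F k (d i))
      (by simpa [Fintype.linearCombination_apply] using h)) i
  obtain ⟨j, hj⟩ := Function.ne_iff.1 hd
  have hj' : algebraMap F k (d j) ≠ 0 := by simpa using hj
  have hz : z = algebraMap F k (c j / d j) := by
    rw [map_div₀, hi j]
    field_simp
  refine ⟨_, hz, funext fun i => (algebraMap F k).injective ?_⟩
  rw [hi i, hz, Pi.smul_apply, smul_eq_mul, map_mul]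

theorem ratVec_ne_zero {e : Fin 3 → E} (he : LinearIndependent k e) {c : Fin 3 → F} (hc : c ≠ 0) :
    ratVec (k := k) F e c ≠ 0 := by
  intro h
  obtain ⟨a, ha, ha'⟩ := exists_eq_smul_of_ratVec_eq_smul he hc (c := 0) (z := 1)
    (by rw [h, smul_zero]; simp [ratVec])
  have : a = 1 := (algebraMap F k).injective (ha.symm.trans (map_one _).symm)
  rw [this, one_smul] at ha'
  exact hc ha'.symm

/-- Coordinates for `(V \ L) ∪ {s}`, where `V` is a Baer subplane that meets the hyperplane `Σ` only
in `q₀`, and `L` is a real line through the point `t` of `Σ`. -/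
theorem exists_baer_coords {K : Type*} [Field K] [Algebra k K] [FiniteDimensional k K] {n : ℕ}
    (hFk : Module.finrank F k = 2)
    {π : Submodule k (BCSpace k K n)} (hπdim : Module.finrank k π = 3)
    (hπS : ¬ π ≤ sigmaHyp k K n) {t q₀ : ℙ k (BCSpace k K n)}
    (htS : t ∈ pointsOf (sigmaHyp k K n)) (hqS : q₀ ∈ pointsOf (sigmaHyp k K n)) (htq : t ≠ q₀)
    (hq₀π : q₀ ∈ pointsOf π) (htπ : t ∈ pointsOf π)
    {V : Set (ℙ k (BCSpace k K n))} (hV : IsBaerSubplane F π V)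
    (hVq₀ : V ∩ pointsOf (t.submodule ⊔ q₀.submodule) = {q₀})
    {L : Submodule k (BCSpace k K n)} (hLdim : Module.finrank k L = 2)
    (htL : t ∈ pointsOf L) (hLreal : 2 ≤ (pointsOf L ∩ V).ncard)
    {s : ℙ k (BCSpace k K n)} (hs : s ∈ V ∩ pointsOf L) :
    ∃ (m t₀ q₁ : Fin n → K) (f : k → k),
      t.submodule = Submodule.span k {((t₀, 0) : BCSpace k K n)} ∧
      q₀.submodule = Submodule.span k {((q₁, 0) : BCSpace k K n)} ∧
      affPt k m ∈ V ∧
      (∀ v, affPt k v ∈ (V \ pointsOf L) ∪ {s} ↔ ∃ y : k, v = m + f y • t₀ + y • q₁) ∧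
      (∀ l : k, l ≠ 0 → ¬ Function.Injective fun y => y + l * f y) ∧
      q₀ ∈ (V \ pointsOf L) ∪ {s} ∧
      ∀ x ∈ (V \ pointsOf L) ∪ {s}, x ∈ pointsOf (sigmaHyp k K n) → x = q₀ := by
  obtain ⟨e, he, heπ, rfl⟩ := hV
  set V : Set (ℙ k (BCSpace k K n)) := {x | ∃ c : Fin 3 → F,
      x.submodule = Submodule.span k {∑ i, algebraMap F k (c i) • e i}} with hVdef
  set ψ : (Fin 3 → F) → BCSpace k K n := ratVec (k := k) F e with hψ
  have hVmem : ∀ x, x ∈ V ↔ ∃ c, x.submodule = Submodule.span k {ψ c} := fun x => Iff.rfl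
  have hψ0 : ψ 0 = 0 := by simp [hψ, ratVec]
  have hψπ : ∀ c, ψ c ∈ π := by
    intro c
    rw [← heπ]
    exact Submodule.sum_mem _ fun i _ =>
      Submodule.smul_mem _ _ (Submodule.subset_span (Set.mem_range_self i))
  have hne0 : ∀ (x : ℙ k (BCSpace k K n)) (v : BCSpace k K n),
      x.submodule = Submodule.span k {v} → v ≠ 0 := by
    rintro x v hx rfl
    have := Projectivization.finrank_submodule x
    rw [hx, Submodule.span_zero_singleton, finrank_bot] at this
    exact zero_ne_one this
  have hVinf : ∀ x : ℙ k (BCSpace k K n), x ∈ V → x ∈ pointsOf (sigmaHyp k K n) → x = q₀ := by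
    intro x hx hxS
    have hle : t.submodule ⊔ q₀.submodule ≤ π ⊓ sigmaHyp k K n :=
      sup_le (le_inf htπ htS) (le_inf hq₀π hqS)
    have hlt : π ⊓ sigmaHyp k K n < π :=
      lt_of_le_of_ne inf_le_left fun h => hπS (h ▸ inf_le_right)
    have h1 := Submodule.finrank_lt_finrank_of_lt hlt
    have h2 := Submodule.eq_of_le_of_finrank_le hle (by rw [finrank_sup_points htq]; omega)
    have h3 : x ∈ V ∩ pointsOf (t.submodule ⊔ q₀.submodule) := by
      refine ⟨hx, ?_⟩
      rw [h2]
      obtain ⟨c, hc⟩ := hx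
      refine le_inf ?_ (mem_pointsOf.1 hxS)
      rw [hc, Submodule.span_singleton_le_iff_mem]
      exact hψπ c
    rw [hVq₀] at h3
    exact h3
  have hq₀V : q₀ ∈ V := (hVq₀.symm ▸ Set.mem_singleton q₀ : q₀ ∈ V ∩ _).1
  have hq₀L : ¬ q₀.submodule ≤ L := by
    intro h
    have hL : t.submodule ⊔ q₀.submodule = L :=
      Submodule.eq_of_le_of_finrank_eq (sup_le htL h) (by rw [finrank_sup_points htq, hLdim])
    rw [← hL, Set.inter_comm, hVq₀, Set.ncard_singleton] at hLreal
    omega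
  obtain ⟨c₀, hc₀⟩ := (hVmem _).1 hq₀V
  have hψc₀ := hne0 _ _ hc₀
  have hc₀0 : c₀ ≠ 0 := fun h => hψc₀ (h ▸ hψ0)
  -- the height function on the rational vectors
  let η : (Fin 3 → F) →ₗ[F] k :=
    { toFun := fun c => (ψ c).2
      map_add' := fun c d => by rw [hψ, ratVec_add]; rfl
      map_smul' := fun a c => by
        rw [hψ, ratVec_smul, Prod.smul_snd, smul_eq_mul, RingHom.id_apply, Algebra.smul_def] }
  -- A nonzero rational vector of height zero gives a point of `V` at infinity, which is `q₀`.
  have hker : ∀ c, η c = 0 → ∃ a : F, c = a • c₀ := by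
    intro c hc
    by_cases h0 : c = 0
    · exact ⟨0, by rw [h0, zero_smul]⟩
    · have hψc := ratVec_ne_zero (F := F) he h0
      have hx : Projectivization.mk k (ψ c) hψc = q₀ :=
        hVinf _ ⟨c, Projectivization.submodule_mk _ _⟩ ((mk_submodule_le hψc).2 (mem_sigmaHyp.2 hc))
      have hm : ψ c ∈ Submodule.span k {ψ c₀} := by
        rw [← hc₀, ← mk_submodule_le hψc, hx]
      obtain ⟨z, hz⟩ := Submodule.mem_span_singleton.1 hm
      obtain ⟨a, -, ha⟩ := exists_eq_smul_of_ratVec_eq_smul he hc₀0 hz.symm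
      exact ⟨a, ha⟩
  have hηc₀ : η c₀ = 0 := by
    have : ψ c₀ ∈ sigmaHyp k K n := by
      rw [← Submodule.span_singleton_le_iff_mem, ← hc₀]
      exact hqS
    exact mem_sigmaHyp.1 this
  -- the rational vectors of `L`
  let M : Submodule F (Fin 3 → F) :=
    { carrier := {c | ψ c ∈ L}
      add_mem' := fun {c d} hc hd => by
        rw [Set.mem_ofPred_eq, hψ, ratVec_add]
        exact L.add_mem hc hd
      zero_mem' := by
        rw [Set.mem_ofPred_eq, hψ0]
        exact L.zero_mem
      smul_mem' := fun a c hc => by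
        rw [Set.mem_ofPred_eq, hψ, ratVec_smul]
        exact L.smul_mem _ hc }
  have hM : ∀ c, c ∈ M ↔ ψ c ∈ L := fun c => Iff.rfl
  have hc₀M : ∀ a : F, a • c₀ ∈ M → a = 0 := by
    intro a ha
    by_contra h0
    rw [Submodule.smul_mem_iff _ h0, hM, ← Submodule.span_singleton_le_iff_mem, ← hc₀] at ha
    exact hq₀L ha
  let ηM : M →ₗ[F] k := η.domRestrict M
  have hinj : Function.Injective ηM := by
    rw [← LinearMap.ker_eq_bot, LinearMap.ker_eq_bot']
    rintro ⟨c, hc⟩ h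
    obtain ⟨a, rfl⟩ := hker c h
    have := hc₀M a hc
    subst this
    ext1
    simp
  have hfinF : FiniteDimensional F k := Module.finite_of_finrank_pos (by omega)
  -- The height is injective on `M`, which bounds its dimension by two; two distinct real points of
  -- `L` give equality. Hence each height in `k` belongs to exactly one rational vector of `L`.
  have hMdim : Module.finrank F M = Module.finrank F k := by
    refine le_antisymm (LinearMap.finrank_le_finrank_of_injective hinj) ?_
    obtain ⟨x₁, ⟨hx₁L, c₁, hc₁⟩, x₂, ⟨hx₂L, c₂, hc₂⟩, hne⟩ :=
      Set.one_lt_ncard_iff_nontrivial_and_finite.1 (lt_of_lt_of_le one_lt_two hLreal) |>.1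
    have hc₁M : c₁ ∈ M := by
      rw [hM, ← Submodule.span_singleton_le_iff_mem]
      exact hc₁.symm.trans_le hx₁L
    have hc₂M : c₂ ∈ M := by
      rw [hM, ← Submodule.span_singleton_le_iff_mem]
      exact hc₂.symm.trans_le hx₂L
    have hli : LinearIndependent F ![(⟨c₁, hc₁M⟩ : M), ⟨c₂, hc₂M⟩] := by
      rw [LinearIndependent.pair_iff' (by
        intro h
        exact hne0 _ _ hc₁ (by rw [← hψ0]; exact congrArg ψ (congrArg Subtype.val h)))]
      intro a ha
      have ha' : a • c₁ = c₂ := congrArg Subtype.val ha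
      apply hne
      symm
      apply eq_of_submodule_le
      rw [hc₁, hc₂, Submodule.span_singleton_le_iff_mem, Submodule.mem_span_singleton]
      refine ⟨algebraMap F k a, ?_⟩
      have := ratVec_smul (k := k) e a c₁
      rw [ha'] at this
      exact this.symm
    have := hli.fintype_card_le_finrank
    rw [hFk]
    simpa using this
  let g : k ≃ₗ[F] M := (LinearEquiv.ofInjectiveOfFinrankEq ηM hinj hMdim).symm
  have hg : ∀ z, η (g z) = z := by
    intro z
    exact (LinearEquiv.ofInjectiveOfFinrankEq ηM hinj hMdim).apply_symm_apply z
  obtain ⟨ω, c, hc1, hcω, hc⟩ := exists_quadratic_coordinate (F := F) (k := k) hFk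
  set m : Fin n → K := (ψ (g 1)).1 with hm
  have hψ1 : ψ (g 1) = (m, 1) := Prod.ext rfl (hg 1)
  have hgL : ∀ z, ψ (g z) ∈ L := fun z => (g z).2
  -- The heights cancel, so `d` is a vector of `L` at infinity, that is, of `t`. It is nonzero
  -- because `ω` is not in `F`.
  set d : BCSpace k K n := ψ (g ω) - ω • ψ (g 1) with hd
  have hdL : d ∈ L := L.sub_mem (hgL _) (L.smul_mem _ (hgL _))
  have hd2 : d.2 = 0 := by
    have h1 : (ψ (g ω)).2 = ω := hg ω
    have h2 : (ψ (g 1)).2 = 1 := hg 1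
    rw [hd, Prod.snd_sub, Prod.smul_snd, h1, h2, smul_eq_mul, mul_one, sub_self]
  have hd0 : d ≠ 0 := by
    intro h
    have hg1 : (g 1 : Fin 3 → F) ≠ 0 := by
      intro h0
      rw [h0, hψ0] at hψ1
      exact zero_ne_one (congrArg Prod.snd hψ1)
    obtain ⟨a, ha, -⟩ := exists_eq_smul_of_ratVec_eq_smul he hg1 (sub_eq_zero.1 h)
    rw [ha, Algebra.algebraMap_eq_smul_one, map_smul, hc1, smul_zero] at hcω
    exact zero_ne_one hcω
  have hmL : ((m, 1) : BCSpace k K n) ∈ L := hψ1 ▸ hgL 1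
  have htd : t.submodule = Submodule.span k {d} := by
    have hLS : L ⊓ sigmaHyp k K n < L := by
      refine lt_of_le_of_ne inf_le_left fun h => ?_
      rw [← h] at hmL
      exact one_ne_zero (mem_sigmaHyp.1 hmL.2)
    have h1 := Submodule.finrank_lt_finrank_of_lt hLS
    have h2 : t.submodule = L ⊓ sigmaHyp k K n :=
      Submodule.eq_of_le_of_finrank_le (le_inf htL htS)
        (by rw [Projectivization.finrank_submodule]; omega)
    have h3 : Projectivization.mk k d hd0 = t := by
      apply eq_of_submodule_le
      rw [mk_submodule_le, h2]
      exact ⟨hdL, mem_sigmaHyp.2 hd2⟩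
    rw [← h3, Projectivization.submodule_mk]
  obtain ⟨t₀, hdt⟩ : ∃ t₀, d = (t₀, 0) := ⟨d.1, Prod.ext rfl hd2⟩
  obtain ⟨q₁, hq₁⟩ : ∃ q₁, ψ c₀ = (q₁, 0) := ⟨(ψ c₀).1, Prod.ext rfl hηc₀⟩
  -- For `z = b + c(z)ω`, linearity over `F` gives `ψ (g z) = z • ψ (g 1) + c(z) • d`.
  have hψg : ∀ z, ψ (g z) = (z • m + algebraMap F k (c z) • t₀, z) := by
    intro z
    obtain ⟨b, hb⟩ := hc z
    have h1 : (g z : Fin 3 → F) = b • (g 1 : Fin 3 → F) + c z • (g ω : Fin 3 → F) := by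
      have : z = b • (1 : k) + c z • ω := by
        rw [Algebra.smul_def, Algebra.smul_def, mul_one]
        exact hb
      conv_lhs => rw [this, map_add, map_smul, map_smul]
      rfl
    have h2 : ψ (g ω) = (ω • m + t₀, ω) := by
      have : ψ (g ω) = d + ω • ψ (g 1) := by rw [hd, sub_add_cancel]
      rw [this, hdt, hψ1]
      ext1
      · simp [add_comm]
      · simp
    rw [h1, hψ, ratVec_add, ratVec_smul, ratVec_smul, ← hψ, h2, hψ1]
    ext1
    · simp only [Prod.smul_mk, Prod.mk_add_mk]
      have hzm : z • m = algebraMap F k b • m + algebraMap F k (c z) • ω • m := by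
        rw [← mul_smul, ← add_smul, ← hb]
      rw [hzm, smul_add]
      abel
    · simp only [Prod.smul_mk, Prod.mk_add_mk, smul_eq_mul, mul_one]
      exact hb.symm
  have hψall : ∀ (z : k) (a : F), ψ ((g z : Fin 3 → F) + a • c₀) =
      (z • m + algebraMap F k (c z) • t₀ + algebraMap F k a • q₁, z) := by
    intro z a
    rw [hψ, ratVec_add, ratVec_smul, ← hψ, hψg, hq₁]
    simp
  have hrep : ∀ x : Fin 3 → F, ∃ a : F, x = (g (η x) : Fin 3 → F) + a • c₀ := by
    intro x
    obtain ⟨a, ha⟩ := hker (x - g (η x)) (by rw [map_sub, hg, sub_self])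
    exact ⟨a, by rw [← ha, add_sub_cancel]⟩
  have hVaff : ∀ v, affPt k v ∈ V ↔ ∃ (z : k) (a : F), z ≠ 0 ∧
      v = m + (algebraMap F k (c z) * z⁻¹) • t₀ + (algebraMap F k a * z⁻¹) • q₁ := by
    have hvec : ∀ (z : k) (a : F), z ≠ 0 →
        z⁻¹ • (z • m + algebraMap F k (c z) • t₀ + algebraMap F k a • q₁) =
          m + (algebraMap F k (c z) * z⁻¹) • t₀ + (algebraMap F k a * z⁻¹) • q₁ := by
      intro z a hz
      rw [smul_add, smul_add, smul_smul, smul_smul, smul_smul, inv_mul_cancel₀ hz, one_smul,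
        mul_comm z⁻¹, mul_comm z⁻¹]
    intro v
    constructor
    · rintro ⟨x, hx⟩
      change _ = Submodule.span k {ψ x} at hx
      obtain ⟨a, ha⟩ := hrep x
      have hz : η x ≠ 0 := by
        intro h
        apply affPt_notMem_sigmaHyp (F := k) v
        rw [mem_pointsOf, hx, Submodule.span_singleton_le_iff_mem, mem_sigmaHyp]
        exact h
      refine ⟨η x, a, hz, ?_⟩
      rw [ha, hψall] at hx
      rw [← hvec _ a hz]
      exact affPt_injective (eq_affPt (w := (_, η x)) hz hx)
    · rintro ⟨z, a, hz, rfl⟩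
      have hw : ((z • m + algebraMap F k (c z) • t₀ + algebraMap F k a • q₁, z) :
          BCSpace k K n) ≠ 0 := fun h => hz (congrArg Prod.snd h)
      rw [← hvec z a hz]
      refine ⟨(g z : Fin 3 → F) + a • c₀, ?_⟩
      change _ = Submodule.span k {ψ _}
      rw [hψall, ← Projectivization.submodule_mk _ hw]
      congr 1
      exact (eq_affPt hz (Projectivization.submodule_mk _ hw)).symm
  have ht₀L : ((t₀, 0) : BCSpace k K n) ∈ L := hdt ▸ hdL
  have hq₁L : ((q₁, 0) : BCSpace k K n) ∉ L := by
    rw [← hq₁, ← Submodule.span_singleton_le_iff_mem, ← hc₀]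
    exact hq₀L
  have hLaff : ∀ x y : k, affPt k (m + x • t₀ + y • q₁) ∈ pointsOf L ↔ y = 0 := by
    intro x y
    rw [mem_pointsOf, affPt_submodule_le]
    have e : ((m + x • t₀ + y • q₁, 1) : BCSpace k K n) =
        ((m, 1) + x • (t₀, 0)) + y • (q₁, 0) := by simp
    rw [e, Submodule.add_mem_iff_right _ (L.add_mem hmL (L.smul_mem _ ht₀L))]
    constructor
    · intro h
      by_contra h0
      exact hq₁L ((L.smul_mem_iff h0).1 h)
    · rintro rfl
      rw [zero_smul]
      exact L.zero_mem
  have hsS : s ∉ pointsOf (sigmaHyp k K n) := by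
    intro h
    have := hVinf s hs.1 h
    subst this
    exact hq₀L hs.2
  obtain ⟨vs, rfl⟩ := exists_eq_affPt hsS
  obtain ⟨zs, as, hzs, hvs⟩ := (hVaff _).1 hs.1
  have has : algebraMap F k as * zs⁻¹ = 0 := by
    have := hs.2
    rwa [hvs, hLaff] at this
  rw [has, zero_smul, add_zero] at hvs
  refine ⟨m, t₀, q₁, baerGraph c (algebraMap F k (c zs) * zs⁻¹), by rw [htd, hdt],
    by rw [hc₀, hq₁], (hVaff m).2 ⟨1, 0, one_ne_zero, by simp [hc1]⟩, fun v => ⟨?_, ?_⟩,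
    fun l hl => baerGraph_not_injective hc1 hcω hc _ hl, Or.inl ⟨hq₀V, hq₀L⟩, ?_⟩
  · rintro (⟨hvV, hvL⟩ | hv)
    · obtain ⟨z, a, hz, rfl⟩ := (hVaff v).1 hvV
      rw [hLaff] at hvL
      refine ⟨algebraMap F k a * z⁻¹, ?_⟩
      rw [baerGraph, if_neg hvL]
      have ha : a ≠ 0 := by
        rintro rfl
        exact hvL (by rw [map_zero, zero_mul])
      have ha' : algebraMap F k a ≠ 0 := by simpa using ha
      -- With `y = a / z`, the `F`-linearity of `c` gives `y * c(y⁻¹) = c(z) / z`. So off `L` the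
      -- coefficient of `t₀` depends on `y` alone.
      have e : (algebraMap F k a * z⁻¹)⁻¹ = a⁻¹ • z := by
        rw [Algebra.smul_def, map_inv₀]
        field_simp
      rw [e, map_smul, smul_eq_mul, map_mul, map_inv₀]
      congr 3
      field_simp
    · have hv' := affPt_injective hv
      exact ⟨0, by rw [baerGraph, if_pos rfl, hv', zero_smul, add_zero, hvs]⟩
  · rintro ⟨y, rfl⟩
    by_cases hy : y = 0
    · right
      rw [baerGraph, if_pos hy, hy, zero_smul, add_zero, hvs]
      rfl
    · left
      -- Scaling the rational vector by `F` allows the choice `a = 1`, hence `z = y⁻¹`.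
      refine ⟨(hVaff _).2 ⟨y⁻¹, 1, inv_ne_zero hy, ?_⟩, by rwa [hLaff]⟩
      rw [baerGraph, if_neg hy, inv_inv, map_one, one_mul, mul_comm]
  · rintro x (⟨hxV, -⟩ | rfl) hxS
    · exact hVinf x hxV hxS
    · exact absurd hxS hsS

end Baer

/-! ### Cardinality of MPS sets -/

section MPSCardinality

/-- The cardinality of a union of cosets of a subgroup is divisible by the order of the subgroup. -/
theorem natCard_dvd_ncard_of_add_mem {G : Type*} [AddCommGroup G] [Finite G] (H : AddSubgroup G)
    (A : Set G) (hA : ∀ a ∈ A, ∀ g ∈ H, g + a ∈ A) : Nat.card H ∣ A.ncard := by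
  have e : A = (QuotientAddGroup.mk : G → G ⧸ H) ⁻¹' (QuotientAddGroup.mk '' A) := by
    refine Set.Subset.antisymm (Set.subset_preimage_image _ _) ?_
    rintro x ⟨a, ha, hax⟩
    have : -a + x ∈ H := QuotientAddGroup.eq.1 hax
    simpa using hA a ha _ this
  have h1 : Nat.card ((QuotientAddGroup.mk : G → G ⧸ H) ⁻¹' (QuotientAddGroup.mk '' A)) =
      Nat.card H * Nat.card ((QuotientAddGroup.mk : G → G ⧸ H) '' A) := by
    rw [← Nat.card_prod]
    exact Nat.card_congr (QuotientAddGroup.preimageMkEquivAddSubgroupProdSet H _)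
  rw [e, ← Nat.card_coe_set_eq, h1]
  exact dvd_mul_right _ _

variable {F K : Type*} [Field F] [Field K] [Algebra F K] {r : ℕ}

theorem finrank_spreadElt (Z : ℙ K (Fin r → K)) :
    Module.finrank F (spreadElt F Z) = Module.finrank F K := by
  obtain ⟨v, hv, hZ⟩ := exists_submodule_eq_span Z
  have e : spreadElt F Z = LinearMap.range
      ((LinearMap.inl F (Fin r → K) F).comp ((LinearMap.toSpanSingleton K (Fin r → K) v).restrictScalars F)) := by
    ext w
    rw [mem_spreadElt, hZ, Submodule.mem_span_singleton]
    constructor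
    · rintro ⟨⟨c, hc⟩, h2⟩
      exact ⟨c, Prod.ext hc h2.symm⟩
    · rintro ⟨c, rfl⟩
      exact ⟨⟨c, rfl⟩, rfl⟩
  rw [e]
  apply LinearMap.finrank_range_of_inj
  intro c d h
  have h1 : c • v = d • v := congrArg Prod.fst h
  exact smul_left_injective K hv h1

theorem mk_eq_of_mem {Z : ℙ K (Fin r → K)} {v : Fin r → K} (hv : v ≠ 0) (h : v ∈ Z.submodule) :
    Projectivization.mk K v hv = Z :=
  eq_of_submodule_le ((mk_submodule_le hv).2 h)

/-- The number of spread elements that meet the cone at infinity, modulo the order of the vertex. -/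
theorem exists_ncard_infinite_part_eq [Finite K] {Y : ℙ K (Fin r → K)}
    {Ω : Submodule F (BCSpace F K r)} (hΩY : Ω ≤ spreadElt F Y) (hΩ0 : Ω ≠ ⊥)
    {u : ℙ F (BCSpace F K r)} (huΩ : ¬ u.submodule ≤ Ω)
    {C : Set (ℙ F (BCSpace F K r))} (hC : C ∩ pointsOf (sigmaHyp F K r) = {u}) :
    ∃ N, {Z | (coneOver Ω C ∩ pointsOf (spreadElt F Z)).Nonempty}.ncard =
      Nat.card Ω * N + 1 := by
  have : Finite (ℙ K (Fin r → K)) := Quotient.finite _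
  have hΩS : Ω ≤ sigmaHyp F K r := hΩY.trans (spreadElt_le_sigmaHyp Y)
  have huCS : u ∈ C ∩ pointsOf (sigmaHyp F K r) := hC.symm ▸ Set.mem_singleton u
  have hmem : ∀ Z : ℙ K (Fin r → K), (coneOver Ω C ∩ pointsOf (spreadElt F Z)).Nonempty ↔
      ∃ v ∈ Ω ⊔ u.submodule, v ≠ 0 ∧ v ∈ spreadElt F Z := by
    intro Z
    constructor
    · rintro ⟨x, hx, hxZ⟩
      obtain ⟨w, hw0, hw⟩ := exists_submodule_eq_span x
      have hwx : w ∈ x.submodule := hw ▸ Submodule.mem_span_singleton_self w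
      rcases le_or_exists_of_mem_coneOver hΩS (hxZ.trans (spreadElt_le_sigmaHyp Z)) hx with
        h | ⟨a, ha, haS, hle⟩
      · exact ⟨w, Submodule.mem_sup_left (h hwx), hw0, hxZ hwx⟩
      · obtain rfl : a = u := by
          have : a ∈ C ∩ pointsOf (sigmaHyp F K r) := ⟨ha, haS⟩
          rwa [hC] at this
        exact ⟨w, hle hwx, hw0, hxZ hwx⟩
    · rintro ⟨v, hv, hv0, hvZ⟩
      exact ⟨Projectivization.mk F v hv0, ⟨u, huCS.1, (mk_submodule_le hv0).2 hv⟩,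
        (mk_submodule_le hv0).2 hvZ⟩
  obtain ⟨ω₀, hω₀, hω₀0⟩ := Submodule.exists_mem_ne_zero_of_ne_bot hΩ0
  have hunique : ∀ Z : ℙ K (Fin r → K), ∀ v ∈ spreadElt F Y, v ≠ 0 → v ∈ spreadElt F Z →
      Z = Y := by
    intro Z v hvY hv0 hvZ
    have h2 := (mem_spreadElt.1 hvY).2
    have h1 : v.1 ≠ 0 := fun h => hv0 (Prod.ext h h2)
    rw [← mk_eq_of_mem h1 (mem_spreadElt.1 hvY).1, ← mk_eq_of_mem h1 (mem_spreadElt.1 hvZ).1]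
  have hY : ∃ v ∈ Ω ⊔ u.submodule, v ≠ 0 ∧ v ∈ spreadElt F Y :=
    ⟨ω₀, Submodule.mem_sup_left hω₀, hω₀0, hΩY hω₀⟩
  obtain ⟨w, hw0, hw⟩ := exists_submodule_eq_span_of_mem_sigmaHyp huCS.2
  -- If `u` lies in `Y`, only `Y` is met. Otherwise the points of `⟨Ω, u⟩` outside `Ω` lie in `|Ω|`
  -- further spread elements, one for each `ω + w`.
  by_cases huY : w ∈ Y.submodule
  · refine ⟨0, ?_⟩
    have hle : Ω ⊔ u.submodule ≤ spreadElt F Y := by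
      refine sup_le hΩY ?_
      rw [hw, Submodule.span_singleton_le_iff_mem, mem_spreadElt]
      exact ⟨huY, rfl⟩
    have e : {Z | (coneOver Ω C ∩ pointsOf (spreadElt F Z)).Nonempty} = {Y} := by
      ext Z
      rw [Set.mem_ofPred_eq, hmem, Set.mem_singleton_iff]
      constructor
      · rintro ⟨v, hv, hv0, hvZ⟩
        exact hunique Z v (hle hv) hv0 hvZ
      · rintro rfl
        exact hY
    rw [e, Set.ncard_singleton, mul_zero]
  · refine ⟨1, ?_⟩
    have hfst : ∀ ω : Ω, ω.1.1 ∈ Y.submodule := fun ω => (mem_spreadElt.1 (hΩY ω.2)).1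
    have hsnd : ∀ ω : Ω, ω.1.2 = 0 := fun ω => (mem_spreadElt.1 (hΩY ω.2)).2
    have hne : ∀ ω : Ω, ω.1.1 + w ≠ 0 := by
      intro ω h
      apply huY
      rw [eq_neg_of_add_eq_zero_right h]
      exact Y.submodule.neg_mem (hfst ω)
    let φ : Ω → ℙ K (Fin r → K) := fun ω => Projectivization.mk K (ω.1.1 + w) (hne ω)
    have hφ : Function.Injective φ := by
      intro ω ω' h
      obtain ⟨c, hc⟩ := (Projectivization.mk_eq_mk_iff' K _ _ _ _).1 h
      have h1 : (1 - c) • w = c • ω'.1.1 - ω.1.1 := by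
        rw [smul_add] at hc
        rw [sub_smul, one_smul, eq_sub_of_add_eq hc.symm]
        abel
      have hc1 : 1 - c = 0 := by
        by_contra h0
        apply huY
        rw [← Submodule.smul_mem_iff _ h0, h1]
        exact Y.submodule.sub_mem (Y.submodule.smul_mem _ (hfst ω')) (hfst ω)
      obtain rfl : c = 1 := (sub_eq_zero.1 hc1).symm
      rw [one_smul, add_left_inj] at hc
      exact Subtype.ext (Prod.ext hc.symm (by rw [hsnd, hsnd]))
    have hYφ : Y ∉ Set.range φ := by
      rintro ⟨ω, h⟩
      apply huY
      have h1 : ω.1.1 + w ∈ Y.submodule := by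
        rw [← mk_submodule_le (F := K) (hne ω)]
        exact (congrArg Projectivization.submodule h).le
      simpa using Y.submodule.sub_mem h1 (hfst ω)
    have e : {Z | (coneOver Ω C ∩ pointsOf (spreadElt F Z)).Nonempty} = insert Y (Set.range φ) := by
      ext Z
      rw [Set.mem_ofPred_eq, hmem, Set.mem_insert_iff]
      constructor
      · rintro ⟨v, hv, hv0, hvZ⟩
        obtain ⟨ω, hω, z, hz, rfl⟩ := Submodule.mem_sup.1 hv
        rw [hw] at hz
        obtain ⟨c, rfl⟩ := Submodule.mem_span_singleton.1 hz
        by_cases hc : c = 0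
        · subst hc
          rw [zero_smul, add_zero] at hv0 hvZ
          exact Or.inl (hunique Z ω (hΩY hω) hv0 hvZ)
        · right
          refine ⟨⟨c⁻¹ • ω, Ω.smul_mem _ hω⟩, mk_eq_of_mem _ ?_⟩
          have := (spreadElt F Z).smul_mem c⁻¹ hvZ
          rw [smul_add, smul_smul, inv_mul_cancel₀ hc, one_smul] at this
          exact (mem_spreadElt.1 this).1
      · rintro (rfl | ⟨ω, rfl⟩)
        · exact hY
        · refine ⟨ω.1 + (w, 0), Submodule.add_mem_sup ω.2 ?_, ?_, ?_⟩
          · rw [hw]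
            exact Submodule.mem_span_singleton_self _
          · exact fun h => hne ω (congrArg Prod.fst h)
          · rw [mem_spreadElt]
            refine ⟨?_, by simp [hsnd]⟩
            exact (mk_submodule_le (hne ω)).1 le_rfl
    rw [e, Set.ncard_insert_of_notMem hYφ, mul_one, ← Set.image_univ,
      Set.ncard_image_of_injective _ hφ, Set.ncard_univ]

/-- The affine part of the cone is invariant under translation by `Ω`, hence a union of cosets. -/
theorem natCard_dvd_ncard_affine_part [Finite K] {Ω : Submodule F (BCSpace F K r)}
    (hΩ : Ω ≤ sigmaHyp F K r) (C : Set (ℙ F (BCSpace F K r))) :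
    Nat.card Ω ∣ {v : Fin r → K | affPt F v ∈ coneOver Ω C}.ncard := by
  let H : Submodule F (Fin r → K) := Ω.comap (LinearMap.inl F (Fin r → K) F)
  have hH : Nat.card H.toAddSubgroup = Nat.card Ω := by
    refine Nat.card_congr (Equiv.ofBijective (fun h => ⟨(h.1, 0), h.2⟩) ⟨?_, ?_⟩)
    · intro a b h
      exact Subtype.ext (congrArg Prod.fst (Subtype.ext_iff.1 h))
    · rintro ⟨ω, hω⟩
      have e : ω = (ω.1, 0) := Prod.ext rfl (mem_sigmaHyp.1 (hΩ hω))
      exact ⟨⟨ω.1, e ▸ hω⟩, Subtype.ext e.symm⟩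
  rw [← hH]
  apply natCard_dvd_ncard_of_add_mem
  intro a ha g hg
  obtain ⟨w, hw, hwa⟩ := (affPt_mem_coneOver hΩ).1 ha
  refine (affPt_mem_coneOver hΩ).2 ⟨w, hw, ?_⟩
  have hg' : ((g, 0) : BCSpace F K r) ∈ Ω := hg
  have e : ((g + a - w, 0) : BCSpace F K r) = (g, 0) + (a - w, 0) := by
    simp [add_sub_assoc]
  rw [e]
  exact Ω.add_mem hg' hwa

/-- The cardinality of a set obtained by the MPS construction is `1` modulo the order of the
vertex of the cone. -/
theorem IsMPSOver.exists_ncard_eq [Finite K] {B : Set (ℙ K (BCSpace K K r))}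
    (hB : IsMPSOver F B) :
    ∃ N, B.ncard = Nat.card F ^ (Module.finrank F K - 1) * N + 1 := by
  obtain ⟨hn, Y, Ω, Γ', t, u, C, hΩY, hΩdim, -, hdisj, -, hC, hCS, -, rfl⟩ := hB
  have hΩS : Ω ≤ sigmaHyp F K r := hΩY.trans (spreadElt_le_sigmaHyp Y)
  rw [finrank_spreadElt] at hΩdim
  have hfin : FiniteDimensional F Ω := Module.finite_of_finrank_pos (by omega)
  have hcard : Nat.card Ω = Nat.card F ^ (Module.finrank F K - 1) := by
    rw [Module.natCard_eq_pow_finrank (K := F) (V := Ω)]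
    congr 1
    omega
  have hΩ0 : Ω ≠ ⊥ := by
    rintro rfl
    rw [finrank_bot] at hΩdim
    omega
  have huC : u ∈ C := (hCS.symm ▸ Set.mem_singleton u : u ∈ C ∩ pointsOf (sigmaHyp F K r)).1
  have huΩ : ¬ u.submodule ≤ Ω := by
    intro h
    have h1 : u.submodule ≤ Γ' ⊓ Ω := le_inf (hC.1 huC) h
    rw [hdisj, le_bot_iff] at h1
    have := Projectivization.finrank_submodule u
    rw [h1, finrank_bot] at this
    exact zero_ne_one this
  obtain ⟨N, hN⟩ := exists_ncard_infinite_part_eq hΩY hΩ0 huΩ hCS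
  obtain ⟨M, hM⟩ := natCard_dvd_ncard_affine_part hΩS C
  refine ⟨M + N, ?_⟩
  rw [representedSet_eq, ncard_affPt_union_pointAtInfinity, hM, hN, ← hcard]
  ring

theorem not_isMPS_of_ncard_eq [Finite K] {q : ℕ} (hq : 2 ≤ q) (hK : Nat.card K = q ^ 6)
    {B : Set (ℙ K (BCSpace K K r))}
    (hB : (B.ncard : ℤ) = 4 * (q : ℤ) ^ 6 - 3 * (q : ℤ) ^ 4 + (q : ℤ) ^ 2 + 1) : ¬ IsMPS B := by
  rintro ⟨F₁, hF⟩
  have hn : 2 ≤ Module.finrank F₁ K := hF.1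
  obtain ⟨N, hN⟩ := hF.exists_ncard_eq
  have hpow : Nat.card F₁ ^ Module.finrank F₁ K = q ^ 6 := by
    rw [← hK, Module.natCard_eq_pow_finrank (K := F₁) (V := K)]
  obtain ⟨m, hm⟩ := Nat.exists_eq_add_of_le hn
  rw [hm] at hN hpow
  -- Compare squares: with `n = 2 + m`, the square of `q₁ ^ (n - 1)` is `q₁ ^ n * q₁ ^ m = q ^ 6 *
  -- q₁ ^ m`.
  have hdvd : q ^ 3 ∣ Nat.card F₁ ^ (2 + m - 1) := by
    rw [← Nat.pow_dvd_pow_iff (n := 2) (by norm_num), ← pow_mul, ← pow_mul]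
    have e : (2 + m - 1) * 2 = (2 + m) + m := by omega
    rw [e, pow_add, hpow]
    exact dvd_mul_right _ _
  obtain ⟨M, hM⟩ := hdvd
  rw [hM] at hN
  have h1 : (q : ℤ) ^ 2 * (q * (M * N - 4 * q ^ 3 + 3 * q) - 1) = 0 := by
    have : (B.ncard : ℤ) = q ^ 3 * M * N + 1 := by exact_mod_cast hN
    linear_combination hB - this
  have hq0 : (q : ℤ) ≠ 0 := by positivity
  have h2 : (q : ℤ) * (M * N - 4 * q ^ 3 + 3 * q) = 1 := by
    rcases mul_eq_zero.1 h1 with h | h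
    · exact absurd h (pow_ne_zero 2 hq0)
    · linear_combination h
  have h3 : (q : ℤ) ∣ 1 := ⟨_, h2.symm⟩
  have h4 := Int.le_of_dvd one_pos h3
  omega

end MPSCardinality

/-! ### A criterion for minimal blocking sets by linear functionals -/

section Minimality

variable {K : Type*} [Field K] {n : ℕ}

theorem finrank_ker_add_one_of_ne_zero {g : BCSpace K K n →ₗ[K] K} (hg : g ≠ 0) :
    Module.finrank K (LinearMap.ker g) + 1 =
      Module.finrank K (⊤ : Submodule K (BCSpace K K n)) := by
  have h := LinearMap.finrank_range_add_finrank_ker g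
  rw [LinearMap.range_eq_top.2 (LinearMap.surjective hg), finrank_top, Module.finrank_self] at h
  rw [finrank_top, ← h, add_comm]

/-- A criterion for a set with one point at infinity to be a minimal blocking set. -/
theorem isMinimalBlockingSetOf_of_functionals {S : Set (Fin n → K)} {X : ℙ K (Fin n → K)}
    {p₀ : Fin n → K} (hp₀ : X.submodule = Submodule.span K {p₀})
    (hblock : ∀ φ : (Fin n → K) →ₗ[K] K, φ p₀ = 1 → ∀ d, ∃ v ∈ S, φ v = d)
    (htangent : ∀ v ∈ S, ∃ φ : (Fin n → K) →ₗ[K] K, φ p₀ = 1 ∧ ∀ w ∈ S, φ w = φ v → w = v) :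
    IsMinimalBlockingSetOf ⊤ (affPt K '' S ∪ pointAtInfinity '' {X}) := by
  have hXle : ∀ H : Submodule K (BCSpace K K n),
      (pointAtInfinity X).submodule ≤ H ↔ (p₀, 0) ∈ H := by
    intro H
    rw [pointAtInfinity_submodule_le, hp₀]
    constructor
    · exact fun h => h p₀ (Submodule.mem_span_singleton_self _)
    · intro h v hv
      obtain ⟨c, rfl⟩ := Submodule.mem_span_singleton.1 hv
      simpa using H.smul_mem c h
  refine ⟨⟨fun x _ => (le_top : x.submodule ≤ ⊤), ?_⟩, ?_⟩
  · intro H _ hH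
    have hlt : H < ⊤ := by
      refine lt_of_le_of_ne le_top ?_
      rintro rfl
      omega
    obtain ⟨g, hg, hle⟩ := H.exists_le_ker_of_lt_top hlt
    have hker := finrank_ker_add_one_of_ne_zero hg
    have hHg : H = LinearMap.ker g := Submodule.eq_of_le_of_finrank_eq hle (by omega)
    by_cases h0 : g (p₀, 0) = 0
    · refine ⟨_, Or.inr ⟨X, rfl, rfl⟩, ?_⟩
      rw [mem_pointsOf, hXle, hHg]
      exact h0
    · obtain ⟨v, hv, hφ⟩ := hblock ((g (p₀, 0))⁻¹ • g ∘ₗ LinearMap.inl K (Fin n → K) K)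
        (by simp [h0]) (-((g (p₀, 0))⁻¹ * g (0, 1)))
      refine ⟨_, Or.inl ⟨v, hv, rfl⟩, ?_⟩
      rw [mem_pointsOf, affPt_submodule_le, hHg, LinearMap.mem_ker]
      have e : ((v, 1) : BCSpace K K n) = (v, 0) + (0, 1) := by simp
      simp only [LinearMap.smul_apply, LinearMap.comp_apply, LinearMap.inl_apply,
        smul_eq_mul] at hφ
      rw [e, map_add]
      field_simp at hφ
      linear_combination hφ
  · intro B' hB' hle
    -- A point is indispensable as soon as some hyperplane meets the set in no other point. Affine
    -- points use the tangent functionals, and the point at infinity uses the hyperplane at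
    -- infinity.
    have key : ∀ x : ℙ K (BCSpace K K n), (∃ g : BCSpace K K n →ₗ[K] K, g ≠ 0 ∧
        ∀ y ∈ affPt K '' S ∪ pointAtInfinity '' {X}, y.submodule ≤ LinearMap.ker g → y = x) →
        x ∈ B' := by
      rintro x ⟨g, hg, hx⟩
      obtain ⟨y, hyB', hy⟩ := hB'.2 (LinearMap.ker g) le_top (finrank_ker_add_one_of_ne_zero hg)
      exact hx y (hle hyB') hy ▸ hyB'
    rintro _ (⟨v, hv, rfl⟩ | ⟨_, rfl, rfl⟩)
    · obtain ⟨φ, hφ, hφv⟩ := htangent v hv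
      refine key _ ⟨φ.coprod (-(φ v) • LinearMap.id), ?_, ?_⟩
      · intro h
        have := LinearMap.congr_fun h (p₀, 0)
        simp [hφ] at this
      · rintro _ (⟨w, hw, rfl⟩ | ⟨_, rfl, rfl⟩) hy
        · rw [affPt_submodule_le, LinearMap.mem_ker] at hy
          simp only [LinearMap.coprod_apply, LinearMap.smul_apply, LinearMap.id_apply,
            smul_eq_mul, mul_one] at hy
          rw [hφv w hw (by linear_combination hy)]
        · rw [hXle, LinearMap.mem_ker] at hy
          simp [hφ] at hy
    · refine key _ ⟨LinearMap.snd K _ K, ?_, ?_⟩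
      · intro h
        have := LinearMap.congr_fun h (0, 1)
        simp at this
      · rintro _ (⟨w, hw, rfl⟩ | ⟨_, rfl, rfl⟩) hy
        · rw [affPt_submodule_le, LinearMap.mem_ker] at hy
          simp at hy
        · rfl

end Minimality

/-! ### Cones with affine vertex, and special points as scalars -/

section ConeCoordinates

variable {k K : Type*} [Field k] [Field K] [Algebra k K] {n : ℕ}

theorem prod_zero_mem_span_iff {v p₀ : Fin n → K} :
    ((v, 0) : BCSpace k K n) ∈ Submodule.span k {((p₀, 0) : BCSpace k K n)} ↔
      ∃ b : k, v = algebraMap k K b • p₀ := by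
  rw [Submodule.mem_span_singleton]
  constructor
  · rintro ⟨b, hb⟩
    refine ⟨b, ?_⟩
    rw [algebraMap_smul]
    exact (congrArg Prod.fst hb).symm
  · rintro ⟨b, rfl⟩
    exact ⟨b, by simp⟩

theorem affPt_mem_coneOver_affPt {L : Submodule k (BCSpace k K n)} (hL : L ≤ sigmaHyp k K n)
    (hL0 : L ≠ ⊥) {w h₀ : Fin n → K} :
    affPt k w ∈ coneOver (affPt k h₀).submodule (pointsOf L) ↔ (w - h₀, 0) ∈ L := by
  constructor
  · rintro ⟨a, ha, hle⟩
    rw [affPt_submodule_le, affPt_submodule] at hle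
    obtain ⟨y, hy, l, hl, hyl⟩ := Submodule.mem_sup.1 hle
    obtain ⟨c, rfl⟩ := Submodule.mem_span_singleton.1 hy
    have hlL : l ∈ L := ha hl
    have hl2 := mem_sigmaHyp.1 (hL hlL)
    have h2 : c * 1 + l.2 = 1 := congrArg Prod.snd hyl
    rw [hl2, add_zero, mul_one] at h2
    have h1 : c • h₀ + l.1 = w := congrArg Prod.fst hyl
    rw [h2, one_smul] at h1
    have e : l = (w - h₀, 0) := Prod.ext (by simp [← h1]) hl2
    exact e ▸ hlL
  · intro hw
    obtain ⟨l, hl, hl0, hle⟩ : ∃ l ∈ L, l ≠ 0 ∧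
        ((w - h₀, 0) : BCSpace k K n) ∈ Submodule.span k {l} := by
      -- The vertex lies on the cone only because the base is nonempty, so any point of `L` serves
      -- here.
      by_cases h0 : ((w - h₀, 0) : BCSpace k K n) = 0
      · obtain ⟨l, hl, hl0⟩ := Submodule.exists_mem_ne_zero_of_ne_bot hL0
        exact ⟨l, hl, hl0, h0 ▸ Submodule.zero_mem _⟩
      · exact ⟨_, hw, h0, Submodule.mem_span_singleton_self _⟩
    refine ⟨Projectivization.mk k l hl0, (mk_submodule_le hl0).2 hl, ?_⟩
    rw [affPt_submodule_le, affPt_submodule, Projectivization.submodule_mk]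
    have e : ((w, 1) : BCSpace k K n) = (h₀, 1) + (w - h₀, 0) := by simp
    rw [e]
    exact Submodule.add_mem_sup (Submodule.mem_span_singleton_self _) hle

theorem coneOver_union {F E : Type*} [Field F] [AddCommGroup E] [Module F E] (Ω : Submodule F E)
    (A B : Set (ℙ F E)) : coneOver Ω (A ∪ B) = coneOver Ω A ∪ coneOver Ω B := by
  ext x
  simp only [coneOver, Set.mem_union, or_and_right, exists_or]
  rfl

/-- The scalars `x` for which the point given by `x • t₀` lies in `L`. -/
def scalarsInto (t₀ : Fin n → K) (L : Submodule k (BCSpace k K n)) : Submodule k K :=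
  L.comap ((LinearMap.inl k (Fin n → K) k).comp
    ((LinearMap.toSpanSingleton K (Fin n → K) t₀).restrictScalars k))

theorem mem_scalarsInto {t₀ : Fin n → K} {L : Submodule k (BCSpace k K n)} {x : K} :
    x ∈ scalarsInto t₀ L ↔ (x • t₀, 0) ∈ L := Iff.rfl

theorem finrank_scalarsInto {X' : ℙ K (Fin n → K)} {t₀ : Fin n → K} (ht₀ : t₀ ≠ 0)
    (hX' : X'.submodule = Submodule.span K {t₀}) {L : Submodule k (BCSpace k K n)}
    (hL : L ≤ spreadElt k X') :
    Module.finrank k (scalarsInto t₀ L) = Module.finrank k L := by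
  let φ : K →ₗ[k] BCSpace k K n := (LinearMap.inl k (Fin n → K) k).comp
    ((LinearMap.toSpanSingleton K (Fin n → K) t₀).restrictScalars k)
  have hφ : Function.Injective φ := by
    intro c d h
    have h1 : c • t₀ = d • t₀ := congrArg Prod.fst h
    exact smul_left_injective K ht₀ h1
  have hmap : (scalarsInto t₀ L).map φ = L := by
    refine Submodule.map_comap_eq_of_le ?_
    intro w hw
    have h := mem_spreadElt.1 (hL hw)
    rw [hX', Submodule.mem_span_singleton] at h
    obtain ⟨⟨c, hc⟩, h2⟩ := h
    exact ⟨c, Prod.ext hc h2.symm⟩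
  rw [(Submodule.equivMapOfInjective φ hφ _).finrank_eq, hmap]

/-- The condition on the lines `L₁, L₂, L₃`, in terms of scalars: a point of `X'` whose scalar is
inverse to an element of `⟨1, ρ⟩` is a special point. -/
theorem isSpecialPoint_of_inv_eq {X X' : ℙ K (Fin 3 → K)} {p r t y : ℙ k (BCSpace k K 3)}
    {p₀ t₀ : Fin 3 → K} {ρ x : K} (ht₀ : t₀ ∉ Submodule.span K {p₀})
    (hp : p.submodule = Submodule.span k {((p₀, 0) : BCSpace k K 3)})
    (hr : r.submodule = Submodule.span k {((ρ • p₀, 0) : BCSpace k K 3)})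
    (ht : t.submodule = Submodule.span k {((t₀, 0) : BCSpace k K 3)})
    (hy : y.submodule = Submodule.span k {((x • t₀, 0) : BCSpace k K 3)}) (hx : x ≠ 0)
    {b a : k} (hxba : x⁻¹ = b • (1 : K) + a • ρ) : IsSpecialPoint X X' p r t y := by
  intro Z _ hyZ
  rw [hy, Submodule.span_singleton_le_iff_mem, hp] at hyZ
  obtain ⟨u, hu, z, hz, huz⟩ := Submodule.mem_sup.1 hyZ
  obtain ⟨μ, rfl⟩ := Submodule.mem_span_singleton.1 hu
  obtain ⟨hz1, hz2⟩ := mem_spreadElt.1 hz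
  have h1 : algebraMap k K μ • p₀ + z.1 = x • t₀ := by
    rw [algebraMap_smul]
    exact congrArg Prod.fst huz
  -- From `x t₀ = μ p₀ + z`, multiplication by `x⁻¹ = b + aρ` gives `t₀ - μaρ p₀ = μb p₀ + x⁻¹ z`.
  -- The left side is in `⟨t, r⟩` and the right side in `⟨p, Z⟩`, since `Z` is closed under `K`.
  set c : K := algebraMap k K (μ * a) * ρ with hc
  have hvne : t₀ - c • p₀ ≠ 0 := by
    intro h
    apply ht₀
    rw [sub_eq_zero.1 h]
    exact Submodule.smul_mem _ _ (Submodule.mem_span_singleton_self _)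
  have hvne' : ((t₀ - c • p₀, 0) : BCSpace k K 3) ≠ 0 := fun h => hvne (congrArg Prod.fst h)
  refine ⟨Projectivization.mk k _ hvne', (mk_submodule_le hvne').2 ?_,
    (mk_submodule_le hvne').2 ?_⟩
  · have e : ((t₀ - c • p₀, 0) : BCSpace k K 3) = (μ * b) • (p₀, 0) + (x⁻¹ • z.1, 0) := by
      refine Prod.ext ?_ (by simp)
      have h2 : z.1 = x • t₀ - algebraMap k K μ • p₀ := eq_sub_of_add_eq' h1
      change t₀ - c • p₀ = (μ * b) • p₀ + x⁻¹ • z.1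
      rw [h2, smul_sub, smul_smul, inv_mul_cancel₀ hx, one_smul, smul_smul, hxba, hc,
        ← algebraMap_smul K (μ * b) p₀]
      have e3 : (b • (1 : K) + a • ρ) * algebraMap k K μ =
          algebraMap k K (μ * b) + algebraMap k K (μ * a) * ρ := by
        simp only [Algebra.smul_def, map_mul]
        ring
      rw [e3, add_smul]
      abel
    rw [e, hp]
    refine Submodule.add_mem_sup
      (Submodule.smul_mem _ _ (Submodule.mem_span_singleton_self _)) ?_
    exact mem_spreadElt.2 ⟨Z.submodule.smul_mem _ hz1, rfl⟩
  · have e : ((t₀ - c • p₀, 0) : BCSpace k K 3) = (t₀, 0) + (-(μ * a)) • (ρ • p₀, 0) := by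
      refine Prod.ext ?_ (by simp)
      change t₀ - c • p₀ = t₀ + (-(μ * a)) • ρ • p₀
      rw [neg_smul, ← algebraMap_smul K (μ * a) (ρ • p₀), smul_smul, sub_eq_add_neg]
    rw [e, ht, hr]
    exact Submodule.add_mem_sup (Submodule.mem_span_singleton_self _)
      (Submodule.smul_mem _ _ (Submodule.mem_span_singleton_self _))

end ConeCoordinates

/-! ### From the geometric configuration to coordinates -/

section Assembly

variable {k K : Type*} [Field k] [Field K] [Algebra k K]

/-- The linear combinations of three vectors. -/
def combMap (p₀ t₀ w : Fin 3 → K) : (K × K × K) →ₗ[K] (Fin 3 → K) :=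
  (LinearMap.toSpanSingleton K _ p₀).coprod
    ((LinearMap.toSpanSingleton K _ t₀).coprod (LinearMap.toSpanSingleton K _ w))

theorem combMap_apply (p₀ t₀ w : Fin 3 → K) (v : K × K × K) :
    combMap p₀ t₀ w v = v.1 • p₀ + (v.2.1 • t₀ + v.2.2 • w) := rfl

theorem combMap_injective {p₀ t₀ w : Fin 3 → K} (hp₀ : p₀ ≠ 0)
    (ht₀ : t₀ ∉ Submodule.span K {p₀}) (hw : ∀ x y : K, w ≠ x • p₀ + y • t₀) :
    Function.Injective (combMap p₀ t₀ w) := by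
  rw [← LinearMap.ker_eq_bot, LinearMap.ker_eq_bot']
  rintro ⟨x, y, z⟩ h
  simp only [combMap_apply] at h
  have hz : z = 0 := by
    by_contra hz
    apply hw (-(z⁻¹ * x)) (-(z⁻¹ * y))
    have h1 : z • w = -(x • p₀) - y • t₀ := by
      rw [← add_assoc, add_comm] at h
      rw [eq_neg_of_add_eq_zero_left h]
      abel
    have h2 : w = z⁻¹ • z • w := by rw [smul_smul, inv_mul_cancel₀ hz, one_smul]
    rw [h2, h1, smul_sub, smul_neg, smul_smul, smul_smul, neg_smul, neg_smul]
    abel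
  subst hz
  rw [zero_smul, add_zero] at h
  have hy : y = 0 := by
    by_contra hy
    apply ht₀
    rw [← Submodule.smul_mem_iff _ hy, eq_neg_of_add_eq_zero_right h]
    exact Submodule.neg_mem _ (Submodule.smul_mem _ _ (Submodule.mem_span_singleton_self _))
  subst hy
  rw [zero_smul, add_zero] at h
  rw [(smul_eq_zero.1 h).resolve_right hp₀]
  rfl

theorem isMinimalBlockingSetOf_of_coords [Finite k] [FiniteDimensional k K]
    (hkK : Module.finrank k K = 3) (hk : 4 ≤ Nat.card k)
    {ρ σ : K} (hb : IsCoordTriple k ρ σ) (f : k → k)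
    (hf : ∀ l : k, l ≠ 0 → ¬ Function.Injective fun y => y + l * f y)
    {N₁ N₂ N₃ : Submodule k K} (h₁ : Module.finrank k N₁ = 2) (h₂ : Module.finrank k N₂ = 2)
    (h₃ : Module.finrank k N₃ = 2) (hN : N₁ ⊓ N₂ ⊓ N₃ = ⊥)
    (hW : ∀ x : K, (x ∈ N₁ ∨ x ∈ N₂ ∨ x ∈ N₃) → x ≠ 0 → ∀ b a : k, x⁻¹ ≠ b • (1 : K) + a • ρ)
    {X : ℙ K (Fin 3 → K)} {p₀ t₀ w : Fin 3 → K} (hp₀ : X.submodule = Submodule.span K {p₀})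
    (hinj : Function.Injective (combMap p₀ t₀ w)) (m : Fin 3 → K) :
    IsMinimalBlockingSetOf ⊤
      (affPt K '' ((fun v => m + combMap p₀ t₀ w v) ''
        (barCoords ρ σ f ∪ tildeCoords N₁ N₂ N₃)) ∪ pointAtInfinity '' {X}) := by
  apply isMinimalBlockingSetOf_of_functionals hp₀
  · intro φ hφ d
    obtain ⟨v, hv, hvd⟩ := exists_coords_eq hkK hb f h₁ h₂ h₃ hN (φ t₀) (φ w) (d - φ m)
    refine ⟨_, ⟨v, hv, rfl⟩, ?_⟩
    simp only [combMap_apply, map_add, map_smul, smul_eq_mul, hφ]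
    linear_combination hvd
  · rintro _ ⟨v, hv, rfl⟩
    have htan : ∃ β γ : K, ∀ u ∈ barCoords ρ σ f ∪ tildeCoords N₁ N₂ N₃,
        u.1 + β * u.2.1 + γ * u.2.2 = v.1 + β * v.2.1 + γ * v.2.2 → u = v := by
      rcases hv with hv | hv
      · exact exists_tangent_of_mem_barCoords hb f hv
      · exact exists_tangent_of_mem_tildeCoords hkK hk hb f hf h₁ h₂ h₃ hN hW hv
    obtain ⟨β, γ, hβγ⟩ := htan
    let e : (K × K × K) ≃ₗ[K] (Fin 3 → K) :=
      LinearEquiv.ofInjectiveOfFinrankEq (combMap p₀ t₀ w) hinj (by simp)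
    have he : ∀ u, e.symm (combMap p₀ t₀ w u) = u := fun u => e.symm_apply_apply u
    let ψ : (K × K × K) →ₗ[K] K := LinearMap.id.coprod
      ((LinearMap.toSpanSingleton K K β).coprod (LinearMap.toSpanSingleton K K γ))
    have hψ : ∀ u : K × K × K, ψ u = u.1 + (u.2.1 * β + u.2.2 * γ) := fun u => rfl
    have hcomp : ∀ u, (ψ ∘ₗ e.symm.toLinearMap) (combMap p₀ t₀ w u) =
        u.1 + (u.2.1 * β + u.2.2 * γ) := by
      intro u
      rw [← hψ]
      exact congrArg ψ (he u)
    refine ⟨ψ ∘ₗ e.symm.toLinearMap, ?_, ?_⟩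
    · have hp : p₀ = combMap p₀ t₀ w (1, 0, 0) := by simp [combMap_apply]
      conv_lhs => rw [hp]
      rw [hcomp]
      simp
    · rintro _ ⟨u, hu, rfl⟩ huv
      simp only [map_add (ψ ∘ₗ e.symm.toLinearMap), hcomp] at huv
      rw [hβγ u hu (by linear_combination huv)]

theorem ncard_of_coords [Finite k] [FiniteDimensional k K] (hkK : Module.finrank k K = 3)
    {ρ σ : K} (hb : IsCoordTriple k ρ σ) (f : k → k)
    {N₁ N₂ N₃ : Submodule k K} (h₁ : Module.finrank k N₁ = 2) (h₂ : Module.finrank k N₂ = 2)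
    (h₃ : Module.finrank k N₃ = 2) (hN : N₁ ⊓ N₂ ⊓ N₃ = ⊥)
    (X : ℙ K (Fin 3 → K)) {p₀ t₀ w : Fin 3 → K}
    (hinj : Function.Injective (combMap p₀ t₀ w)) (m : Fin 3 → K) :
    ((affPt K '' ((fun v => m + combMap p₀ t₀ w v) ''
        (barCoords ρ σ f ∪ tildeCoords N₁ N₂ N₃)) ∪ pointAtInfinity '' {X}).ncard : ℤ) =
      4 * (Nat.card k : ℤ) ^ 3 - 3 * (Nat.card k : ℤ) ^ 2 + Nat.card k + 1 := by
  have : Finite K := Module.finite_of_finite k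
  rw [ncard_affPt_union_pointAtInfinity, Set.ncard_singleton,
    Set.ncard_image_of_injective _ fun a b h => hinj (add_left_cancel h)]
  push_cast
  rw [ncard_coords hkK hb f h₁ h₂ h₃ hN]

theorem affPt_mem_barB {V : Set (ℙ k (BCSpace k K 3))} {L : Submodule k (BCSpace k K 3)}
    {s r : ℙ k (BCSpace k K 3)} {m t₀ p₀ : Fin 3 → K} {ρ σ : K} {f : k → k}
    (hr : r.submodule = Submodule.span k {((ρ • p₀, 0) : BCSpace k K 3)})
    (hVs : ∀ v, affPt k v ∈ (V \ pointsOf L) ∪ {s} ↔ ∃ y : k, v = m + f y • t₀ + y • σ • p₀)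
    {v : Fin 3 → K} :
    affPt k v ∈ barB r V L s ↔
      ∃ a y : k, v = m + (a • ρ + y • σ) • p₀ + algebraMap k K (f y) • t₀ := by
  have hrS : r.submodule ≤ sigmaHyp k K 3 := by
    rw [hr, Submodule.span_singleton_le_iff_mem, mem_sigmaHyp]
  rw [barB, affPt_mem_coneOver hrS]
  simp only [hVs, hr, prod_zero_mem_span_iff]
  have e : ∀ a y : k, m + (a • ρ + y • σ) • p₀ + algebraMap k K (f y) • t₀ =
      m + f y • t₀ + y • σ • p₀ + algebraMap k K a • ρ • p₀ := by
    intro a y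
    rw [algebraMap_smul, algebraMap_smul, add_smul, smul_assoc, smul_assoc]
    abel
  constructor
  · rintro ⟨w, ⟨y, rfl⟩, a, ha⟩
    exact ⟨a, y, by rw [e, ← ha, add_sub_cancel]⟩
  · rintro ⟨a, y, rfl⟩
    exact ⟨_, ⟨y, rfl⟩, a, by rw [e, add_sub_cancel_left]⟩

theorem affPt_mem_tildeB {X' : ℙ K (Fin 3 → K)} {t₀ h₀ : Fin 3 → K}
    (hX' : X'.submodule = Submodule.span K {t₀}) {L₁ L₂ L₃ : Submodule k (BCSpace k K 3)}
    (hL₁dim : Module.finrank k L₁ = 2) (hL₂dim : Module.finrank k L₂ = 2)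
    (hL₃dim : Module.finrank k L₃ = 2)
    (hL₁X' : L₁ ≤ spreadElt k X') (hL₂X' : L₂ ≤ spreadElt k X') (hL₃X' : L₃ ≤ spreadElt k X')
    {v : Fin 3 → K} :
    affPt k v ∈ tildeB (affPt k h₀) L₁ L₂ L₃ ↔ ∃ n : K, (n ∈ scalarsInto t₀ L₁ ∨
      n ∈ scalarsInto t₀ L₂ ∨ n ∈ scalarsInto t₀ L₃) ∧ v = h₀ + n • t₀ := by
  have hne : ∀ L : Submodule k (BCSpace k K 3), Module.finrank k L = 2 → L ≠ ⊥ := by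
    rintro _ h rfl
    rw [finrank_bot] at h
    omega
  have hS := spreadElt_le_sigmaHyp (F := k) X'
  have hiff : ∀ L : Submodule k (BCSpace k K 3), L ≤ spreadElt k X' →
      ((v - h₀, 0) ∈ L ↔ ∃ n ∈ scalarsInto t₀ L, v = h₀ + n • t₀) := by
    intro L hL
    constructor
    · intro h
      have h1 := (mem_spreadElt.1 (hL h)).1
      rw [hX', Submodule.mem_span_singleton] at h1
      obtain ⟨n, hn⟩ := h1
      refine ⟨n, ?_, by rw [hn]; simp⟩
      rw [mem_scalarsInto, hn]
      exact h
    · rintro ⟨n, hn, rfl⟩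
      rw [add_sub_cancel_left]
      exact hn
  rw [tildeB, Set.mem_sdiff, and_iff_left (affPt_notMem_sigmaHyp v), coneOver_union,
    coneOver_union, Set.mem_union, Set.mem_union,
    affPt_mem_coneOver_affPt (hL₁X'.trans hS) (hne _ hL₁dim),
    affPt_mem_coneOver_affPt (hL₂X'.trans hS) (hne _ hL₂dim),
    affPt_mem_coneOver_affPt (hL₃X'.trans hS) (hne _ hL₃dim),
    hiff _ hL₁X', hiff _ hL₂X', hiff _ hL₃X']
  constructor
  · rintro ((⟨n, hn, h⟩ | ⟨n, hn, h⟩) | ⟨n, hn, h⟩)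
    · exact ⟨n, Or.inl hn, h⟩
    · exact ⟨n, Or.inr (Or.inl hn), h⟩
    · exact ⟨n, Or.inr (Or.inr hn), h⟩
  · rintro ⟨n, hn | hn | hn, h⟩
    · exact Or.inl (Or.inl ⟨n, hn, h⟩)
    · exact Or.inl (Or.inr ⟨n, hn, h⟩)
    · exact Or.inr ⟨n, hn, h⟩

/-- The points at infinity of the cone with vertex `p` over `barB ∪ tildeB` lie in `X`. -/
theorem le_spreadElt_of_mem_coneOver {X : ℙ K (Fin 3 → K)} {p r q₀ s h : ℙ k (BCSpace k K 3)}
    {V : Set (ℙ k (BCSpace k K 3))} {L L₁ L₂ L₃ : Submodule k (BCSpace k K 3)}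
    (hp : p.submodule ≤ spreadElt k X) (hr : r.submodule ≤ spreadElt k X)
    (hq₀ : q₀.submodule ≤ spreadElt k X)
    (hVs : ∀ x ∈ (V \ pointsOf L) ∪ {s}, x ∈ pointsOf (sigmaHyp k K 3) → x = q₀)
    {x : ℙ k (BCSpace k K 3)} (hxS : x ∈ pointsOf (sigmaHyp k K 3))
    (hx : x ∈ coneOver p.submodule (barB r V L s ∪ tildeB h L₁ L₂ L₃)) :
    x.submodule ≤ spreadElt k X := by
  have hS := spreadElt_le_sigmaHyp (F := k) X
  rcases le_or_exists_of_mem_coneOver (hp.trans hS) hxS hx with hle | ⟨a, ha | ha, haS, hle⟩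
  · exact hle.trans hp
  · refine hle.trans (sup_le hp ?_)
    rcases le_or_exists_of_mem_coneOver (hr.trans hS) haS ha with hle' | ⟨b, hb, hbS, hle'⟩
    · exact hle'.trans hr
    · rw [hVs b hb hbS] at hle'
      exact hle'.trans (sup_le hr hq₀)
  · exact absurd haS ha.2

/-- Distinct spread elements share no point, so a cone whose points at infinity all lie in `X` meets
no other one; its vertex `p` shows that `X` is met. -/
theorem setOf_meets_coneOver {X : ℙ K (Fin 3 → K)} {p : ℙ k (BCSpace k K 3)}
    (hp : p.submodule ≤ spreadElt k X) {A : Set (ℙ k (BCSpace k K 3))} (hA : A.Nonempty)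
    (hle : ∀ x ∈ coneOver p.submodule A, x ∈ pointsOf (sigmaHyp k K 3) →
      x.submodule ≤ spreadElt k X) :
    {Z | (coneOver p.submodule A ∩ pointsOf (spreadElt k Z)).Nonempty} = {X} := by
  ext Z
  rw [Set.mem_ofPred_eq, Set.mem_singleton_iff]
  constructor
  · rintro ⟨x, hx, hxZ⟩
    have hxS : x ∈ pointsOf (sigmaHyp k K 3) := hxZ.trans (spreadElt_le_sigmaHyp Z)
    have hxX := hle x hx hxS
    obtain ⟨v, hv, hxv⟩ := exists_submodule_eq_span_of_mem_sigmaHyp hxS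
    rw [mem_pointsOf, hxv, Submodule.span_singleton_le_iff_mem, mem_spreadElt] at hxZ
    rw [hxv, Submodule.span_singleton_le_iff_mem, mem_spreadElt] at hxX
    rw [← mk_eq_of_mem hv hxZ.1, ← mk_eq_of_mem hv hxX.1]
  · rintro rfl
    obtain ⟨a, ha⟩ := hA
    exact ⟨p, ⟨a, ha, le_sup_left⟩, hp⟩

/-- `B` in coordinates. -/
theorem representedSet_eq_coords {X X' : ℙ K (Fin 3 → K)} {p r q₀ s : ℙ k (BCSpace k K 3)}
    {V : Set (ℙ k (BCSpace k K 3))} {L L₁ L₂ L₃ : Submodule k (BCSpace k K 3)}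
    {m t₀ p₀ h₀ : Fin 3 → K} {ρ σ : K} {f : k → k}
    (hX : X.submodule = Submodule.span K {p₀}) (hX' : X'.submodule = Submodule.span K {t₀})
    (hp : p.submodule = Submodule.span k {((p₀, 0) : BCSpace k K 3)})
    (hr : r.submodule = Submodule.span k {((ρ • p₀, 0) : BCSpace k K 3)})
    (hq₀ : q₀.submodule ≤ spreadElt k X)
    (hVs : ∀ v, affPt k v ∈ (V \ pointsOf L) ∪ {s} ↔ ∃ y : k, v = m + f y • t₀ + y • σ • p₀)
    (hVinf : ∀ x ∈ (V \ pointsOf L) ∪ {s}, x ∈ pointsOf (sigmaHyp k K 3) → x = q₀)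
    (hL₁dim : Module.finrank k L₁ = 2) (hL₂dim : Module.finrank k L₂ = 2)
    (hL₃dim : Module.finrank k L₃ = 2)
    (hL₁X' : L₁ ≤ spreadElt k X') (hL₂X' : L₂ ≤ spreadElt k X') (hL₃X' : L₃ ≤ spreadElt k X') :
    representedSet (coneOver p.submodule (barB r V L s ∪ tildeB (affPt k h₀) L₁ L₂ L₃)) =
      affPt K '' ((fun v => m + combMap p₀ t₀ (h₀ - m) v) '' (barCoords ρ σ f ∪
        tildeCoords (scalarsInto t₀ L₁) (scalarsInto t₀ L₂) (scalarsInto t₀ L₃))) ∪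
      pointAtInfinity '' {X} := by
  have hle : ∀ c : K, Submodule.span k {((c • p₀, 0) : BCSpace k K 3)} ≤ spreadElt k X := by
    intro c
    rw [Submodule.span_singleton_le_iff_mem, mem_spreadElt, hX]
    exact ⟨Submodule.smul_mem _ _ (Submodule.mem_span_singleton_self _), rfl⟩
  have hpX : p.submodule ≤ spreadElt k X := by
    have := hle 1
    rwa [one_smul, ← hp] at this
  have hrX : r.submodule ≤ spreadElt k X := hr ▸ hle ρ
  rw [representedSet_eq, setOf_meets_coneOver hpX ⟨affPt k (m + (0 + (0 : k) • σ) • p₀ +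
    algebraMap k K (f 0) • t₀), Or.inl ((affPt_mem_barB hr hVs).2 ⟨0, 0, by simp⟩)⟩
    fun x hx hxS => le_spreadElt_of_mem_coneOver hpX hrX hq₀ hVinf hxS hx]
  congr 2
  ext v
  rw [Set.mem_ofPred_eq, affPt_mem_coneOver (hpX.trans (spreadElt_le_sigmaHyp X))]
  simp only [Set.mem_union, affPt_mem_barB hr hVs,
    affPt_mem_tildeB hX' hL₁dim hL₂dim hL₃dim hL₁X' hL₂X' hL₃X', hp, prod_zero_mem_span_iff]
  constructor
  · rintro ⟨w, ⟨a, y, rfl⟩ | ⟨n, hn, rfl⟩, b, hb⟩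
    · refine ⟨_, Or.inl ⟨b, a, y, rfl⟩, ?_⟩
      rw [sub_eq_iff_eq_add] at hb
      simp only [hb, combMap_apply, zero_smul, add_zero, add_smul,
        ← Algebra.algebraMap_eq_smul_one]
      abel
    · refine ⟨_, Or.inr ⟨b, n, hn, rfl⟩, ?_⟩
      rw [sub_eq_iff_eq_add] at hb
      simp only [hb, combMap_apply, one_smul]
      abel
  · rintro ⟨_, ⟨b, a, y, rfl⟩ | ⟨b, n, hn, rfl⟩, rfl⟩
    · refine ⟨_, Or.inl ⟨a, y, rfl⟩, b, ?_⟩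
      simp only [combMap_apply, zero_smul, add_zero, add_smul, ← Algebra.algebraMap_eq_smul_one]
      abel
    · refine ⟨_, Or.inr ⟨n, hn, rfl⟩, b, ?_⟩
      simp only [combMap_apply, one_smul]
      abel

/-- The points `r ≠ q₀` span a line inside `Θ`, which misses `p`; the three points are therefore
independent in a plane over `k`. -/
theorem isCoordTriple_of_points [Finite k] [FiniteDimensional k K]
    (hkK : Module.finrank k K = 3) {n : ℕ} {Θ : Submodule k (BCSpace k K n)} {p₀ : Fin n → K}
    {r q₀ : ℙ k (BCSpace k K n)} {ρ σ : K} (hp₀ : ((p₀, 0) : BCSpace k K n) ∉ Θ) (hrq : r ≠ q₀)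
    (hrΘ : r.submodule ≤ Θ) (hqΘ : q₀.submodule ≤ Θ)
    (hr : r.submodule = Submodule.span k {((ρ • p₀, 0) : BCSpace k K n)})
    (hq₀ : q₀.submodule = Submodule.span k {((σ • p₀, 0) : BCSpace k K n)}) :
    IsCoordTriple k ρ σ := by
  have : Finite K := Module.finite_of_finite k
  have hinj : Function.Injective
      (fun c : k × k × k => c.1 • (1 : K) + c.2.1 • ρ + c.2.2 • σ) := by
    let φ : (k × k × k) →ₗ[k] K := (LinearMap.toSpanSingleton k K 1).coprod
      ((LinearMap.toSpanSingleton k K ρ).coprod (LinearMap.toSpanSingleton k K σ))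
    have hφ : ∀ c : k × k × k, φ c = c.1 • (1 : K) + c.2.1 • ρ + c.2.2 • σ := fun c => by
      rw [add_assoc]; rfl
    suffices Function.Injective φ by
      intro c d h
      exact this (by rw [hφ, hφ]; exact h)
    rw [← LinearMap.ker_eq_bot, LinearMap.ker_eq_bot']
    rintro ⟨b, a, y⟩ h
    rw [hφ] at h
    have hvec : b • ((p₀, 0) : BCSpace k K n) + a • (ρ • p₀, 0) + y • (σ • p₀, 0) = 0 := by
      refine Prod.ext ?_ (by simp)
      have := congrArg (fun c : K => c • p₀) h
      simpa [add_smul] using this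
    have hrm : ((ρ • p₀, 0) : BCSpace k K n) ∈ r.submodule :=
      hr ▸ Submodule.mem_span_singleton_self _
    have hqm : ((σ • p₀, 0) : BCSpace k K n) ∈ q₀.submodule :=
      hq₀ ▸ Submodule.mem_span_singleton_self _
    have hb : b = 0 := by
      by_contra hb
      apply hp₀
      rw [add_assoc] at hvec
      rw [← Θ.smul_mem_iff hb, eq_neg_of_add_eq_zero_left hvec]
      exact Θ.neg_mem (Θ.add_mem (Θ.smul_mem _ (hrΘ hrm)) (Θ.smul_mem _ (hqΘ hqm)))
    subst hb
    rw [zero_smul, zero_add] at hvec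
    have ha : a = 0 := by
      by_contra ha
      apply hrq
      apply eq_of_submodule_le
      rw [hr, Submodule.span_singleton_le_iff_mem, ← Submodule.smul_mem_iff _ ha,
        eq_neg_of_add_eq_zero_left hvec]
      exact Submodule.neg_mem _ (Submodule.smul_mem _ _ hqm)
    subst ha
    rw [zero_smul, zero_add] at hvec
    have hy : y = 0 := by
      by_contra hy
      have h0 := (smul_eq_zero.1 hvec).resolve_left hy
      have := Projectivization.finrank_submodule q₀
      rw [hq₀, h0, Submodule.span_zero_singleton, finrank_bot] at this
      exact zero_ne_one this
    subst hy
    rfl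
  refine hinj.bijective_of_nat_card_le ?_
  rw [Nat.card_prod, Nat.card_prod, Module.natCard_eq_pow_finrank (K := k) (V := K), hkK]
  exact le_of_eq (by ring)

end Assembly

/-! ### The theorem -/

theorem theorem8
    {F k K : Type*} [Field F] [Finite F] [Field k] [Field K] [Algebra F k] [Algebra k K]
    (hFk : Module.finrank F k = 2) (hkK : Module.finrank k K = 3)
    (q : ℕ) (hq : Nat.card F = q)
    -- the spread elements `X ≠ X'` and the point `p` of `X`
    (X X' : ℙ K (Fin 3 → K)) (hXX' : X ≠ X')
    (p : ℙ k (BCSpace k K 3)) (hp : p ∈ pointsOf (spreadElt k X))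
    -- the subspaces `Γ` of dimension 7 and `Γ'` of dimension 8
    (Γ Γ' : Submodule k (BCSpace k K 3))
    (hΓ : Γ ≤ sigmaHyp k K 3) (hΓdim : Module.finrank k Γ = 8)
    (hX'Γ : spreadElt k X' ≤ Γ) (hpΓ : p ∉ pointsOf Γ)
    (hΓ'dim : Module.finrank k Γ' = 9) (hΓ' : Γ' ⊓ sigmaHyp k K 3 = Γ)
    -- the line `Θ = Γ ∩ X = ⟨r, q₀⟩`
    (r q₀ : ℙ k (BCSpace k K 3)) (hΘ : Γ ⊓ spreadElt k X = r.submodule ⊔ q₀.submodule)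
    -- the plane `π` of `Γ'` with its Baer subplane `V`
    (t : ℙ k (BCSpace k K 3)) (ht : t ∈ pointsOf (spreadElt k X'))
    (π : Submodule k (BCSpace k K 3)) (hπdim : Module.finrank k π = 3) (hπΓ' : π ≤ Γ')
    (hπS : ¬ π ≤ sigmaHyp k K 3) (hq₀π : q₀ ∈ pointsOf π) (htπ : t ∈ pointsOf π)
    (V : Set (ℙ k (BCSpace k K 3))) (hV : IsBaerSubplane F π V)
    (hVq₀ : V ∩ pointsOf (t.submodule ⊔ q₀.submodule) = {q₀})
    -- the real line `L` of `π` through `t` and the point `s`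
    (L : Submodule k (BCSpace k K 3)) (hLdim : Module.finrank k L = 2) (hLπ : L ≤ π)
    (htL : t ∈ pointsOf L) (hLreal : (pointsOf L ∩ V).ncard = q + 1)
    (s : ℙ k (BCSpace k K 3)) (hs : s ∈ V ∩ pointsOf L)
    -- the lines `L₁, L₂, L₃` of `X'`
    (L₁ L₂ L₃ : Submodule k (BCSpace k K 3))
    (hL₁dim : Module.finrank k L₁ = 2) (hL₂dim : Module.finrank k L₂ = 2)
    (hL₃dim : Module.finrank k L₃ = 2)
    (hL₁X' : L₁ ≤ spreadElt k X') (hL₂X' : L₂ ≤ spreadElt k X') (hL₃X' : L₃ ≤ spreadElt k X')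
    (hLLL : L₁ ⊓ L₂ ⊓ L₃ = ⊥)
    (htLi : t ∉ pointsOf L₁ ∪ pointsOf L₂ ∪ pointsOf L₃)
    (htildet : ∀ t' ∈ pointsOf (spreadElt k X'), t' ≠ t → IsSpecialPoint X X' p r t t' →
      t' ∉ pointsOf L₁ ∪ pointsOf L₂ ∪ pointsOf L₃)
    -- the point `h`
    (h : ℙ k (BCSpace k K 3)) (hhΓ' : h ∈ pointsOf Γ') (hhS : h ∉ pointsOf (sigmaHyp k K 3))
    (hhXX'V : h ∉ pointsOf (spreadElt k X ⊔ spreadElt k X' ⊔ ⨆ v ∈ V, v.submodule))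
    (B : Set (ℙ K (BCSpace K K 3)))
    (hB : B = representedSet (coneOver p.submodule (barB r V L s ∪ tildeB h L₁ L₂ L₃))) :
    IsMinimalBlockingSetOf ⊤ B ∧
    (B.ncard : ℤ) = 4 * (q : ℤ) ^ 6 - 3 * (q : ℤ) ^ 4 + (q : ℤ) ^ 2 + 1 ∧
    ¬ ∃ (σ : ℙ K (BCSpace K K 3) ≃ ℙ K (BCSpace K K 3)) (B' : Set (ℙ K (BCSpace K K 3))),
      IsCollineation σ ∧ IsMPS B' ∧ σ '' B = B' := by
  have hfinK : FiniteDimensional k K := Module.finite_of_finrank_pos (by omega)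
  have hfink : FiniteDimensional F k := Module.finite_of_finrank_pos (by omega)
  have hkfin : Finite k := Module.finite_of_finite F
  have hKfin : Finite K := Module.finite_of_finite k
  have hq2 : 2 ≤ q := hq ▸ Finite.one_lt_card
  have hkcard : Nat.card k = q ^ 2 := by
    rw [Module.natCard_eq_pow_finrank (K := F) (V := k), hFk, hq]
  have hKcard : Nat.card K = q ^ 6 := by
    rw [Module.natCard_eq_pow_finrank (K := k) (V := K), hkK, hkcard]
    ring
  have hk4 : 4 ≤ Nat.card k := hkcard ▸ Nat.pow_le_pow_left hq2 2
  -- vectors for the points at infinity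
  have hXS := spreadElt_le_sigmaHyp (F := k) X
  have hX'S := spreadElt_le_sigmaHyp (F := k) X'
  have hrΘ : r.submodule ≤ Γ ⊓ spreadElt k X := hΘ ▸ le_sup_left
  have hqΘ : q₀.submodule ≤ Γ ⊓ spreadElt k X := hΘ ▸ le_sup_right
  obtain ⟨p₀, hp₀0, hpp₀⟩ := exists_submodule_eq_span_of_mem_sigmaHyp (hp.trans hXS)
  have hp₀X : p₀ ∈ X.submodule := by
    rw [mem_pointsOf, hpp₀, Submodule.span_singleton_le_iff_mem, mem_spreadElt] at hp
    exact hp.1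
  have hXspan : X.submodule = Submodule.span K {p₀} := by
    rw [← mk_eq_of_mem hp₀0 hp₀X, Projectivization.submodule_mk]
  have hscalar : ∀ v : Fin 3 → K, ((v, 0) : BCSpace k K 3) ∈ spreadElt k X →
      ∃ c : K, c • p₀ = v := by
    intro v hv
    have := (mem_spreadElt.1 hv).1
    rwa [hXspan, Submodule.mem_span_singleton] at this
  -- By dimensions in `Σ`, the intersection of `Γ` and `X` has rank at least `8 + 3 - 9 = 2`, so it
  -- is not a point.
  have hrq : r ≠ q₀ := by
    rintro rfl
    rw [sup_idem] at hΘ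
    have h1 := Submodule.finrank_sup_add_finrank_inf_eq Γ (spreadElt k X)
    rw [hΘ, Projectivization.finrank_submodule, finrank_spreadElt, hkK, hΓdim] at h1
    have h2 : Module.finrank k (sigmaHyp k K 3) ≤ 9 := by
      have e : sigmaHyp k K 3 = LinearMap.range (LinearMap.inl k (Fin 3 → K) k) := by
        ext v
        rw [mem_sigmaHyp]
        exact ⟨fun h => ⟨v.1, Prod.ext rfl h.symm⟩, by rintro ⟨w, rfl⟩; rfl⟩
      rw [e]
      refine (LinearMap.finrank_range_le _).trans ?_
      rw [Module.finrank_pi_fintype]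
      simp [hkK]
    have h3 := Submodule.finrank_mono (sup_le hΓ hXS)
    omega
  have htq : t ≠ q₀ := by
    rintro rfl
    obtain ⟨v, hv0, hv⟩ := exists_submodule_eq_span_of_mem_sigmaHyp (ht.trans hX'S)
    have h1 := hqΘ.trans inf_le_right
    rw [mem_pointsOf, hv, Submodule.span_singleton_le_iff_mem, mem_spreadElt] at ht
    rw [hv, Submodule.span_singleton_le_iff_mem, mem_spreadElt] at h1
    exact hXX' ((mk_eq_of_mem hv0 h1.1).symm.trans (mk_eq_of_mem hv0 ht.1))
  obtain ⟨m, t₀, q₁, f, htt₀, hqq₁, hmV, hVaff, hf, -, hVinf⟩ := exists_baer_coords hFk hπdim hπS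
    (ht.trans hX'S) ((hqΘ.trans inf_le_right).trans hXS) htq hq₀π htπ hV hVq₀ hLdim htL
    (by omega) hs
  obtain ⟨r₁, -, hrr₁⟩ := exists_submodule_eq_span_of_mem_sigmaHyp
    ((hrΘ.trans inf_le_right).trans hXS)
  obtain ⟨ρ, rfl⟩ := hscalar r₁ (by
    rw [← Submodule.span_singleton_le_iff_mem, ← hrr₁]
    exact hrΘ.trans inf_le_right)
  obtain ⟨σ, rfl⟩ := hscalar q₁ (by
    rw [← Submodule.span_singleton_le_iff_mem, ← hqq₁]
    exact hqΘ.trans inf_le_right)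
  have hpΓ' : ((p₀, 0) : BCSpace k K 3) ∉ Γ := by
    rwa [mem_pointsOf, hpp₀, Submodule.span_singleton_le_iff_mem] at hpΓ
  have hb : IsCoordTriple k ρ σ := isCoordTriple_of_points hkK hpΓ' hrq
    (hrΘ.trans inf_le_left) (hqΘ.trans inf_le_left) hrr₁ hqq₁
  have ht₀X' : t₀ ∈ X'.submodule := by
    rw [mem_pointsOf, htt₀, Submodule.span_singleton_le_iff_mem, mem_spreadElt] at ht
    exact ht.1
  have ht₀0 : t₀ ≠ 0 := by
    rintro rfl
    have := Projectivization.finrank_submodule t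
    rw [htt₀] at this
    erw [Submodule.span_zero_singleton, finrank_bot] at this
    exact zero_ne_one this
  have hX'span : X'.submodule = Submodule.span K {t₀} := by
    rw [← mk_eq_of_mem ht₀0 ht₀X', Projectivization.submodule_mk]
  have ht₀X : t₀ ∉ Submodule.span K {p₀} := by
    rw [← hXspan]
    intro h0
    exact hXX' ((mk_eq_of_mem ht₀0 h0).symm.trans (mk_eq_of_mem ht₀0 ht₀X'))
  -- the point `h` is outside `⟨X, X', V⟩`
  obtain ⟨h₀, rfl⟩ := exists_eq_affPt hhS
  have hw : ∀ x y : K, h₀ - m ≠ x • p₀ + y • t₀ := by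
    intro x y hxy
    apply hhXX'V
    rw [mem_pointsOf, affPt_submodule_le]
    have e : ((h₀, 1) : BCSpace k K 3) = ((x • p₀, 0) + (y • t₀, 0)) + (m, 1) := by
      refine Prod.ext ?_ (by simp)
      change h₀ = x • p₀ + y • t₀ + m
      rw [← hxy, sub_add_cancel]
    rw [e]
    refine Submodule.add_mem_sup (Submodule.add_mem_sup ?_ ?_) ?_
    · exact mem_spreadElt.2 ⟨X.submodule.smul_mem _ hp₀X, rfl⟩
    · exact mem_spreadElt.2 ⟨X'.submodule.smul_mem _ ht₀X', rfl⟩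
    · have hle : (affPt k m).submodule ≤ ⨆ v ∈ V, v.submodule :=
        le_iSup₂_of_le (affPt k m) hmV le_rfl
      exact affPt_submodule_le.1 hle
  have hinj := combMap_injective hp₀0 ht₀X hw
  -- the lines `L₁, L₂, L₃`
  have hN₁ := (finrank_scalarsInto ht₀0 hX'span hL₁X').trans hL₁dim
  have hN₂ := (finrank_scalarsInto ht₀0 hX'span hL₂X').trans hL₂dim
  have hN₃ := (finrank_scalarsInto ht₀0 hX'span hL₃X').trans hL₃dim
  have hN : scalarsInto t₀ L₁ ⊓ scalarsInto t₀ L₂ ⊓ scalarsInto t₀ L₃ = ⊥ := by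
    rw [Submodule.eq_bot_iff]
    rintro x ⟨⟨hx₁, hx₂⟩, hx₃⟩
    have h0 : ((x • t₀, 0) : BCSpace k K 3) ∈ L₁ ⊓ L₂ ⊓ L₃ := ⟨⟨hx₁, hx₂⟩, hx₃⟩
    rw [hLLL, Submodule.mem_bot] at h0
    exact (smul_eq_zero.1 (congrArg Prod.fst h0)).resolve_right ht₀0
  -- A scalar whose inverse is in `⟨1, ρ⟩` gives either `t` itself or another special point of `X'`;
  -- both are excluded from the three lines.
  have hW : ∀ x : K, (x ∈ scalarsInto t₀ L₁ ∨ x ∈ scalarsInto t₀ L₂ ∨ x ∈ scalarsInto t₀ L₃) →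
      x ≠ 0 → ∀ b a : k, x⁻¹ ≠ b • (1 : K) + a • ρ := by
    intro x hx hx0 b a hxba
    have hv : ((x • t₀, 0) : BCSpace k K 3) ≠ 0 := fun h0 =>
      smul_ne_zero hx0 ht₀0 (congrArg Prod.fst h0)
    have hyL : Projectivization.mk k _ hv ∈ pointsOf L₁ ∪ pointsOf L₂ ∪ pointsOf L₃ := by
      rcases hx with hx | hx | hx
      · exact Or.inl (Or.inl ((mk_submodule_le hv).2 hx))
      · exact Or.inl (Or.inr ((mk_submodule_le hv).2 hx))
      · exact Or.inr ((mk_submodule_le hv).2 hx)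
    refine htildet (Projectivization.mk k _ hv) ?_ (fun h0 => htLi (h0 ▸ hyL)) ?_ hyL
    · exact (mk_submodule_le hv).2 (mem_spreadElt.2 ⟨X'.submodule.smul_mem _ ht₀X', rfl⟩)
    · exact isSpecialPoint_of_inv_eq ht₀X hpp₀ hrr₁ htt₀ (Projectivization.submodule_mk _ _) hx0 hxba
  have hBcoords := hB.trans (representedSet_eq_coords (h₀ := h₀) hXspan hX'span hpp₀ hrr₁
    (hqΘ.trans inf_le_right) hVaff hVinf hL₁dim hL₂dim hL₃dim hL₁X' hL₂X' hL₃X')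
  have hcard : (B.ncard : ℤ) = 4 * (q : ℤ) ^ 6 - 3 * (q : ℤ) ^ 4 + (q : ℤ) ^ 2 + 1 := by
    rw [hBcoords, ncard_of_coords hkK hb f hN₁ hN₂ hN₃ hN X hinj m, hkcard]
    push_cast
    ring
  refine ⟨?_, hcard, ?_⟩
  · rw [hBcoords]
    exact isMinimalBlockingSetOf_of_coords hkK hk4 hb f hf hN₁ hN₂ hN₃ hN hW hXspan hinj m
  · rintro ⟨τ, B', -, hMPS, rfl⟩
    refine not_isMPS_of_ncard_eq hq2 hKcard ?_ hMPS
    rw [Set.ncard_image_of_injective _ τ.injective]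
    exact hcard
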